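/- **Setting.** There are $U$ users with preference vectors $\theta_u\in\mathbb R^d$, $\|\theta_u\|_2\le 1$, partitioned into clusters $\mathcal V(1),\dots,\mathcal V(J)$ such that $\theta_u=\theta_v$ if and only if $u,v$ lie in the same cluster; $j_u$ is the cluster index of $u$, and $\|\theta_u-\theta_v\|_2\ge\gamma>0$ for users in different clusters. User $u$ has $N_u$ samples $(a_u^i,r_u^i)$; for a set $\mathcal S$ of users put $N_{\mathcal S}=\sum_{v\in\mathcal S}N_v$. *Actions.* Let $\rho$ be a probability distribution on the closed unit ball of $\mathbb R^d$ such that $\mathbb E_{a\sim\rho}[aa^\top]$ has minimum eigenvalue $\lambda_a>0$ and, for every unit vector $v$, $Z=(v^\top a)^2$ satisfies $\Pr(Z-\mathbb EZ\ge t)\le e^{-t^2/(2\sigma^2)}$ and $\Pr(Z-\mathbb EZ\le -t)\le e^{-t^2/(2\sigma^2)}$ for all $t\ge0$, where $\sigma>0$. Each $a_u^i$ is selected, by an arbitrary rule, from a candidate set of at most $S$ vectors; the candidate vectors of each user are i.i.d. with law $\rho$. Put $\tilde\lambda_a=\int_0^{\lambda_a}\bigl(1-e^{-(\lambda_a-x)^2/(2\sigma^2)}\bigr)^S\,dx$.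 *Rewards.* The rewards are drawn one after the other in some order; given the action $a_u^i$ and everything observed before, $r_u^i$ has mean $\langle\theta_u,a_u^i\rangle$ and is $1$-sub-Gaussian. **Algorithm Off-CLUB** (parameters $\alpha,\lambda,\delta$; $\tilde\lambda_a$ known). Put $\beta(n)=\sqrt{d\log(1+\frac{n}{\lambda d})+2\log\frac{2U}{\delta}}+\sqrt\lambda$. For each user let $M_u=\lambda I+\sum_i a_u^i(a_u^i)^\top$, $\hat\theta_u=M_u^{-1}\sum_i r_u^ia_u^i$ and $\mathrm{CI}_u=\beta(N_u)/\sqrt{\tilde\lambda_aN_u/2}$. Start from the complete graph on the users and remove every edge $(u,v)$ with $\|\hat\theta_u-\hat\theta_v\|_2>\alpha(\mathrm{CI}_u+\mathrm{CI}_v)$. For test user $u_{\rm test}$, pool the samples of $u_{\rm test}$ and of its remaining neighbours; let $\tilde N$ be their number, $\tilde M=\lambda I+\sum aa^\top$ and $\tilde\theta=\tilde M^{-1}\sum ra$ (sums over the pooled samples). Given an action set $\mathcal A$ in the closed unit ball, output a maximizer $a_{\rm test}$ over $a\in\mathcal A$ of $\tilde\theta^\top a-\beta(\tilde N)\sqrt{a^\top\tilde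 M^{-1}a}$. Its suboptimality is $\mathrm{SubOpt}=\sup_{a\in\mathcal A}\langle\theta_{u_{\rm test}},a\rangle-\langle\theta_{u_{\rm test}},a_{\rm test}\rangle$. **Theorem (upper bound for Off-CLUB).** Let $\delta\in(0,\tfrac12)$, $\alpha=1$, $\lambda>0$, and put $T_\gamma=\frac{512d}{\gamma^2\tilde\lambda_a}\log\frac{2U}{\delta}$. Assume that the dataset is completely $\delta$-sufficient, that is, for every user $u$, $$N_u\ge\max\Bigl\{\tfrac{16}{\tilde\lambda_a^2}\log\tfrac{8dU}{\tilde\lambda_a^2\delta},\ T_\gamma\Bigr\},$$ and that the parameters satisfy $\lambda\le d\log\bigl(1+\frac{N_u}{\lambda d}\bigr)+2\log\frac{2U}{\delta}$ for every $u$, and $\delta\le\frac{2U}{1+T_\gamma/(\lambda d)}$. Then with probability at least $1-2\delta$ the following hold simultaneously. All users are clustered correctly: for every user $u$, its connected component in the final graph, and also the set consisting of $u$ and its neighbours, equals $\mathcal V(j_u)$. Moreover, for every test user $u_{\rm test}$ and every action set $\mathcal A$ in the closed unit ball, with $N=N_{\mathcal V(j_{u_{\rm test}})}$, $$\mathrm{SubOpt}\le\frac{2\beta(N)}{\sqrt{\lambda+\tilde\lambda_aN/2}}\qquad\text{and}\qquad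 \mathrm{SubOpt}\le 8\sqrt{\frac{d}{\tilde\lambda_aN}}\ \sqrt{\log\Bigl(1+\frac{N}{\lambda d}\Bigr)+\log\frac{2U}{\delta}},$$ so that $\mathrm{SubOpt}=\tilde O\bigl(\sqrt{d/(\tilde\lambda_aN)}\bigr)$. -/

import Mathlib

open MeasureTheory ProbabilityTheory
open scoped RealInnerProductSpace Matrix

noncomputable section

namespace OffClusBand

/-- `ℝ^d` with the Euclidean inner product and norm. -/
abbrev Vec (d : ℕ) := EuclideanSpace ℝ (Fin d)

/-! ### Offline datasets and the Off-CLUB algorithm -/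

/-- An offline dataset for `U` users: `N u` samples `(a_u^i, r_u^i)` for each user `u`. -/
structure Dataset (U d : ℕ) where
  N : Fin U → ℕ
  act : (u : Fin U) → Fin (N u) → Vec d
  rew : (u : Fin U) → Fin (N u) → ℝ

/-- Total number of samples `N_V = ∑_{v ∈ V} N_v` of a set of users. -/
def sampleCount {U : ℕ} (N : Fin U → ℕ) (V : Finset (Fin U)) : ℕ := ∑ v ∈ V, N v

/-- `√(d log(1 + n/(λ d)) + 2 log(2U/δ)) + √λ`. -/
def confRadius (U d : ℕ) (lam δ : ℝ) (n : ℕ) : ℝ :=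
  √(d * Real.log (1 + n / (lam * d)) + 2 * Real.log (2 * U / δ)) + √lam

namespace Dataset

variable {U d : ℕ} (D : Dataset U d)

/-- Regularized Gram matrix `λ I + ∑ a aᵀ` over all samples of the users in `V`. -/
def gram (lam : ℝ) (V : Finset (Fin U)) : Matrix (Fin d) (Fin d) ℝ :=
  lam • (1 : Matrix (Fin d) (Fin d) ℝ)
    + ∑ v ∈ V, ∑ i : Fin (D.N v), Matrix.vecMulVec (D.act v i).ofLp (D.act v i).ofLp

/-- `∑ r a` over all samples of the users in `V`. -/
def moment (V : Finset (Fin U)) : Fin d → ℝ :=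
  ∑ v ∈ V, ∑ i : Fin (D.N v), D.rew v i • (D.act v i).ofLp

/-- Ridge regression estimate from the pooled samples of the users in `V`. -/
def ridge (lam : ℝ) (V : Finset (Fin U)) : Vec d :=
  WithLp.toLp 2 ((D.gram lam V)⁻¹ *ᵥ D.moment V)

/-- Confidence width `CI_u`; `lt` is the smoothed regularity parameter given to the algorithm. -/
def CI (lam lt δ : ℝ) (u : Fin U) : ℝ :=
  confRadius U d lam δ (D.N u) / √(lt * D.N u / 2)

/-- The graph left by the Cluster Phase: start from the complete graph and remove the edge `(u, v)`
if `‖θ̂_u - θ̂_v‖ > α (CI_u + CI_v)`. -/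
def graph (α lam lt δ : ℝ) : SimpleGraph (Fin U) where
  Adj u v := u ≠ v ∧
    ¬ (‖D.ridge lam {u} - D.ridge lam {v}‖ > α * (D.CI lam lt δ u + D.CI lam lt δ v))
  symm := ⟨fun u v h => ⟨h.1.symm, by
    rw [norm_sub_rev, add_comm (D.CI lam lt δ v)]; exact h.2⟩⟩
  loopless := ⟨fun _ h => h.1 rfl⟩

open Classical in
/-- User `u` together with its neighbours in the final graph: the users whose data are pooled
for `u`. -/
def pool (α lam lt δ : ℝ) (u : Fin U) : Finset (Fin U) :=
  Finset.univ.filter fun v => v = u ∨ (D.graph α lam lt δ).Adj u v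

/-- The pessimistic value `θ̃_uᵀ a - β ‖a‖_{M̃_u⁻¹}` computed from the pooled data of `u`. -/
def pessimisticValue (α lam lt δ : ℝ) (u : Fin U) (a : Vec d) : ℝ :=
  ⟪D.ridge lam (D.pool α lam lt δ u), a⟫
    - confRadius U d lam δ (sampleCount D.N (D.pool α lam lt δ u))
      * √(a.ofLp ⬝ᵥ ((D.gram lam (D.pool α lam lt δ u))⁻¹ *ᵥ a.ofLp))

/-- `a` is an output of Off-CLUB for test user `u` and action set `A`: a maximizer over `A` of the
pessimistic value (ties broken arbitrarily). -/
def IsOffCLUBAction (α lam lt δ : ℝ) (u : Fin U) (A : Set (Vec d)) (a : Vec d) : Prop :=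
  a ∈ A ∧ ∀ b ∈ A, D.pessimisticValue α lam lt δ u b ≤ D.pessimisticValue α lam lt δ u a

/-- All users are clustered correctly, where `cl u` is the true cluster index of user `u`: the
connected component of every user in the final graph, and also the set of users pooled for it, is
exactly its true cluster. -/
def ClustersCorrectly {J : ℕ} (cl : Fin U → Fin J) (α lam lt δ : ℝ) : Prop :=
  ∀ u, ((D.graph α lam lt δ).connectedComponentMk u).supp = {v | cl v = cl u} ∧
    (D.pool α lam lt δ u : Set (Fin U)) = {v | cl v = cl u}

end Dataset

/-- The true cluster `V(j_u)` of user `u`. -/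
def trueCluster {U J : ℕ} (cl : Fin U → Fin J) (u : Fin U) : Finset (Fin U) :=
  Finset.univ.filter fun v => cl v = cl u

/-- Suboptimality gap of the action `a` for preference vector `θ` and action set `A`; the supremum
is `⟨θ, a*⟩` whenever an optimal action `a*` exists. -/
def subOpt {d : ℕ} (θ : Vec d) (A : Set (Vec d)) (a : Vec d) : ℝ :=
  sSup ((fun b => ⟪θ, b⟫) '' A) - ⟪θ, a⟫

/-! ### Stochastic assumptions -/

/-- `E_{a ∼ ρ}[a aᵀ]`. -/
def secondMoment {d : ℕ} (ρ : Measure (Vec d)) : Matrix (Fin d) (Fin d) ℝ :=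
  Matrix.of fun i j => ∫ a, a i * a j ∂ρ

/-- `X` has sub-Gaussian tails (around its mean) with variance parameter `σ²`. -/
def HasSubgaussianTails {α : Type*} [MeasurableSpace α] (X : α → ℝ) (σ : ℝ) (μ : Measure α) :
    Prop :=
  ∀ t : ℝ, 0 ≤ t →
    μ.real {x | X x - ∫ y, X y ∂μ ≥ t} ≤ Real.exp (-t ^ 2 / (2 * σ ^ 2)) ∧
    μ.real {x | X x - ∫ y, X y ∂μ ≤ -t} ≤ Real.exp (-t ^ 2 / (2 * σ ^ 2))

/-- Regularity of the action distribution `ρ`: it lives on the closed unit ball, the minimum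
eigenvalue of `E[a aᵀ]` is `lamA > 0`, and `(vᵀ a)²` has sub-Gaussian tails with parameter `σ²`
for every unit vector `v`. -/
structure ActionRegular {d : ℕ} (ρ : Measure (Vec d)) (lamA σ : ℝ) : Prop where
  isProb : IsProbabilityMeasure ρ
  norm_le : ∀ᵐ a ∂ρ, ‖a‖ ≤ 1
  minEigenvalue : IsLeast (spectrum ℝ (secondMoment ρ)) lamA
  lamA_pos : 0 < lamA
  sigma_pos : 0 < σ
  tails : ∀ v : Vec d, ‖v‖ = 1 → HasSubgaussianTails (fun a : Vec d => ⟪v, a⟫ ^ 2) σ ρ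

/-- The smoothed regularity parameter `∫_0^{λ_a} (1 - exp(-(λ_a - x)²/(2σ²)))^S dx`. -/
def smoothedReg (lamA σ : ℝ) (S : ℕ) : ℝ :=
  ∫ x in (0 : ℝ)..lamA, (1 - Real.exp (-(lamA - x) ^ 2 / (2 * σ ^ 2))) ^ S

/-- A random offline dataset with preference vectors `θ`, on a probability space `(Ω, P)`.

*Actions.* The action of sample `(u, i)` is an element of a candidate set of at most `S` vectors;
the candidate vectors of each user are independent with law `ρ`. The selection rule is arbitrary
(it may use past data).

*Rewards.* The rewards are drawn one after the other, sample `(u, i)` at time `time ⟨u, i⟩`, and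
`ℱ n` is the information present just before the draw at time `n`, including the action of that
sample. Given this information, the reward has mean `⟨θ_u, a_u^i⟩` and is 1-sub-Gaussian (the bound
on the conditional moment generating function for all `s` contains the statement on the mean).
Rewards that are conditionally independent given all actions are the special case in which all
actions are already `ℱ 0`-measurable; actions of an adaptive logging policy are also covered. -/
structure OfflineData {Ω : Type*} [mΩ : MeasurableSpace Ω] (P : Measure Ω) {U d : ℕ}
    (θ : Fin U → Vec d) (ρ : Measure (Vec d)) (S : ℕ) where
  N : Fin U → ℕ
  act : (u : Fin U) → Fin (N u) → Ω → Vec d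
  rew : (u : Fin U) → Fin (N u) → Ω → ℝ
  numCand : (u : Fin U) → Fin (N u) → ℕ
  numCand_le : ∀ u i, numCand u i ≤ S
  cand : (u : Fin U) → (i : Fin (N u)) → Fin (numCand u i) → Ω → Vec d
  cand_measurable : ∀ u i j, Measurable (cand u i j)
  cand_law : ∀ u i j, P.map (cand u i j) = ρ
  cand_indep : ∀ u, iIndepFun
    (fun (p : (i : Fin (N u)) × Fin (numCand u i)) => cand u p.1 p.2) P
  act_mem : ∀ u i, ∀ᵐ ω ∂P, ∃ j, act u i ω = cand u i j ω
  ℱ : Filtration ℕ mΩ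
  time : ((u : Fin U) × Fin (N u)) → ℕ
  time_injective : Function.Injective time
  act_measurable : ∀ u i, Measurable[ℱ (time ⟨u, i⟩)] (act u i)
  rew_measurable : ∀ u i, Measurable[ℱ (time ⟨u, i⟩ + 1)] (rew u i)
  noise_integrable : ∀ u i (s : ℝ),
    Integrable (fun ω => Real.exp (s * (rew u i ω - ⟪θ u, act u i ω⟫))) P
  noise_subgaussian : ∀ u i (s : ℝ),
    P[fun ω => Real.exp (s * (rew u i ω - ⟪θ u, act u i ω⟫)) | ℱ (time ⟨u, i⟩)]
      ≤ᵐ[P] fun _ => Real.exp (s ^ 2 / 2)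

/-- The dataset observed at the outcome `ω`. -/
def OfflineData.dataset {Ω : Type*} [MeasurableSpace Ω] {P : Measure Ω} {U d : ℕ}
    {θ : Fin U → Vec d} {ρ : Measure (Vec d)} {S : ℕ} (X : OfflineData P θ ρ S) (ω : Ω) :
    Dataset U d where
  N := X.N
  act u i := X.act u i ω
  rew u i := X.rew u i ω

/-- The sample size that separates clusters at distance `γ`:
`(512 d / (γ² λ̃)) log(2U/δ)`. -/
def gapThreshold (U d : ℕ) (lt γ δ : ℝ) : ℝ :=
  512 * d / (γ ^ 2 * lt) * Real.log (2 * U / δ)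

/-- The dataset of every user is `δ`-sufficient. -/
def CompletelySufficient {U : ℕ} (d : ℕ) (N : Fin U → ℕ) (lt γ δ : ℝ) : Prop :=
  ∀ u, max (16 / lt ^ 2 * Real.log (8 * d * U / (lt ^ 2 * δ))) (gapThreshold U d lt γ δ)
    ≤ (N u : ℝ)

end OffClusBand

end

/-! The argument isolates one event of probability at least `1 - 2δ` on which everything is
deterministic. On it, (i) the unregularized Gram matrix of every user `u` has smallest eigenvalue at
least `λ̃ N_u / 2`, and (ii) the self-normalized noise of the pooled ridge regression is bounded for
every single user and for every true cluster.

For (i), the chosen action has, along a fixed unit vector `w`, a squared component at least the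
minimum over its candidate set. These minima are independent over the samples of one user whatever
the selection rule, and by the layer-cake formula their means are at least `λ̃`
(`smoothedReg_le_integral_minSq`). A Chernoff bound, a union over a net of the sphere and a
perturbation step (`half_le_sum_inner_sq_of_near`) give all directions. The size of the net is
exponential in `d`; this is absorbed because `d λ̃ ≤ 1` (`dim_mul_le_one`).

For (ii), the method of mixtures is used: exponential supermartingales are averaged over a Gaussian
prior of precision `λ`, Markov's inequality is applied to the explicit Gaussian integral, and the
determinant is bounded through the trace (`measure_noise_gt_le`).

On this event `‖θ̂_u - θ_u‖ ≤ CI_u < γ/4`, so the edge test with `α = 1` keeps exactly the edges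
inside clusters (`graph_adj_iff`). Each pool is then a fixed set, the true cluster, for which (ii)
is available, and pessimism bounds the suboptimality by twice the confidence width at the comparison
action (`subOpt_le`). -/

namespace OffClusBand

/-! ### Quadratic forms of positive definite matrices -/

section LinearAlgebra

variable {n : Type*} [Fintype n] [DecidableEq n]

theorem exists_transpose_mul_self {A : Matrix n n ℝ} (hA : A.PosSemidef) :
    ∃ C : Matrix n n ℝ, A = Cᵀ * C := by
  open scoped MatrixOrder in
  obtain ⟨B, rfl⟩ := CStarAlgebra.nonneg_iff_eq_star_mul_self.mp hA.nonneg
  exact ⟨B, by rw [Matrix.star_eq_conjTranspose, Matrix.conjTranspose_eq_transpose_of_trivial]⟩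

theorem dotProduct_transpose_mul_self {n : Type*} [Fintype n] (C : Matrix n n ℝ) (x y : n → ℝ) :
    x ⬝ᵥ ((Cᵀ * C) *ᵥ y) = (C *ᵥ x) ⬝ᵥ (C *ᵥ y) := by
  rw [← Matrix.mulVec_mulVec, Matrix.dotProduct_mulVec, Matrix.vecMul_transpose]

/-- Cauchy–Schwarz for the bilinear form of a positive semidefinite matrix. -/
theorem dotProduct_mulVec_le_sqrt_mul_sqrt {A : Matrix n n ℝ} (hA : A.PosSemidef) (x y : n → ℝ) :
    x ⬝ᵥ (A *ᵥ y) ≤ √(x ⬝ᵥ (A *ᵥ x)) * √(y ⬝ᵥ (A *ᵥ y)) := by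
  obtain ⟨C, rfl⟩ := exists_transpose_mul_self hA
  simp only [dotProduct_transpose_mul_self]
  have h := Finset.sum_mul_sq_le_sq_mul_sq Finset.univ (C *ᵥ x) (C *ᵥ y)
  rw [← Real.sqrt_mul (by simpa [dotProduct, ← sq] using Finset.sum_nonneg fun i _ => sq_nonneg _)]
  refine Real.le_sqrt_of_sq_le ?_
  simpa [dotProduct, ← sq] using h

/-- With `y = A⁻¹ b`, the hypothesis at `y` reads `m |y|² ≤ b·y`. Cauchy–Schwarz then gives `m
(b·y)² ≤ |b|² (b·y)`, and `b·y` cancels unless it is zero. -/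
theorem dotProduct_inv_mulVec_le {A : Matrix n n ℝ} (hA : A.PosDef) {m : ℝ} (hm : 0 < m)
    (h : ∀ x : n → ℝ, m * (x ⬝ᵥ x) ≤ x ⬝ᵥ (A *ᵥ x)) (b : n → ℝ) :
    b ⬝ᵥ (A⁻¹ *ᵥ b) ≤ (b ⬝ᵥ b) / m := by
  set y := A⁻¹ *ᵥ b with hy
  have hAy : A *ᵥ y = b := by
    rw [hy, Matrix.mulVec_mulVec, Matrix.mul_nonsing_inv _ (by simpa using hA.det_pos.ne'),
      Matrix.one_mulVec]
  have h1 := h y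
  rw [hAy, dotProduct_comm y b] at h1
  have h2 : (b ⬝ᵥ y) ^ 2 ≤ (b ⬝ᵥ b) * (y ⬝ᵥ y) := by
    simpa [dotProduct, ← sq] using Finset.sum_mul_sq_le_sq_mul_sq Finset.univ b y
  have hbb : 0 ≤ b ⬝ᵥ b := by
    simpa [dotProduct, ← sq] using Finset.sum_nonneg fun i _ => sq_nonneg _
  have hyy : 0 ≤ y ⬝ᵥ y := by
    simpa [dotProduct, ← sq] using Finset.sum_nonneg fun i _ => sq_nonneg _
  rw [le_div_iff₀ hm]
  have h0 : 0 ≤ b ⬝ᵥ y := (mul_nonneg hm.le hyy).trans h1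
  rcases h0.eq_or_lt with h0 | h0
  · rw [← h0]; simpa using hbb
  · refine le_of_mul_le_mul_left ?_ h0
    nlinarith [mul_le_mul_of_nonneg_left h1 hbb, mul_le_mul_of_nonneg_left h2 hm.le]

/-- The inequality of arithmetic and geometric means for the eigenvalues. -/
theorem det_le_trace_div_card_pow [Nonempty n] {A : Matrix n n ℝ} (hA : A.PosDef) :
    A.det ≤ (A.trace / Fintype.card n) ^ Fintype.card n := by
  have hc : (0 : ℝ) < Fintype.card n := by exact_mod_cast Fintype.card_pos
  have h := Real.geom_mean_le_arith_mean Finset.univ (fun _ => (1 : ℝ)) hA.1.eigenvalues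
    (fun _ _ => zero_le_one) (by simpa using hc) (fun i _ => (hA.eigenvalues_pos i).le)
  simp only [Real.rpow_one, Finset.sum_const, Finset.card_univ, nsmul_eq_mul, mul_one,
    one_mul] at h
  have hdet : A.det = ∏ i, hA.1.eigenvalues i := by
    simpa using hA.1.det_eq_prod_eigenvalues
  have htr : A.trace = ∑ i, hA.1.eigenvalues i := by
    simpa using hA.1.trace_eq_sum_eigenvalues
  rw [htr, hdet]
  have h0 : 0 ≤ ∏ i, hA.1.eigenvalues i := Finset.prod_nonneg fun i _ => (hA.eigenvalues_pos i).le
  calc ∏ i, hA.1.eigenvalues i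
      = ((∏ i, hA.1.eigenvalues i) ^ ((Fintype.card n : ℝ)⁻¹)) ^ Fintype.card n := by
        rw [← Real.rpow_natCast, ← Real.rpow_mul h0, inv_mul_cancel₀ hc.ne', Real.rpow_one]
    _ ≤ _ := pow_le_pow_left₀ (Real.rpow_nonneg h0 _) h _

end LinearAlgebra

/-! ### Deterministic error bounds for ridge regression -/

namespace Dataset

variable {U d : ℕ} (D : Dataset U d)

theorem dotProduct_ofLp_self (x : Vec d) : x.ofLp ⬝ᵥ x.ofLp = ‖x‖ ^ 2 := by
  rw [EuclideanSpace.real_norm_sq_eq]; simp [dotProduct, sq]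

theorem dotProduct_ofLp (x y : Vec d) : x.ofLp ⬝ᵥ y.ofLp = ⟪x, y⟫ := by
  simp [PiLp.inner_apply, dotProduct, mul_comm]

theorem gram_mulVec (lam : ℝ) (V : Finset (Fin U)) (x : Vec d) :
    D.gram lam V *ᵥ x.ofLp = lam • x.ofLp
      + ∑ v ∈ V, ∑ i : Fin (D.N v), ⟪x, D.act v i⟫ • (D.act v i).ofLp := by
  simp only [gram, Matrix.add_mulVec, Matrix.smul_mulVec, Matrix.one_mulVec, Matrix.sum_mulVec,
    Matrix.vecMulVec_mulVec, dotProduct_ofLp, real_inner_comm]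
  simp

theorem dotProduct_gram_mulVec (lam : ℝ) (V : Finset (Fin U)) (x : Vec d) :
    x.ofLp ⬝ᵥ (D.gram lam V *ᵥ x.ofLp) = lam * ‖x‖ ^ 2
      + ∑ v ∈ V, ∑ i : Fin (D.N v), ⟪x, D.act v i⟫ ^ 2 := by
  simp only [gram_mulVec, dotProduct_add, dotProduct_smul, dotProduct_sum, dotProduct_ofLp,
    smul_eq_mul, real_inner_self_eq_norm_sq, sq]

theorem gram_isHermitian (lam : ℝ) (V : Finset (Fin U)) : (D.gram lam V).IsHermitian := by
  unfold gram
  refine Matrix.IsHermitian.ext fun i j => ?_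
  simp [Matrix.sum_apply, Matrix.vecMulVec_apply, Matrix.one_apply, mul_comm, eq_comm]

theorem gram_posDef {lam : ℝ} (hlam : 0 < lam) (V : Finset (Fin U)) : (D.gram lam V).PosDef := by
  refine Matrix.PosDef.of_dotProduct_mulVec_pos (D.gram_isHermitian lam V) fun x hx => ?_
  have h := D.dotProduct_gram_mulVec lam V (WithLp.toLp 2 x)
  simp only [star_trivial]
  simp only at h
  rw [h]
  have : 0 < ‖WithLp.toLp 2 x‖ := norm_pos_iff.2 (by simpa using hx)
  have h2 : 0 ≤ ∑ v ∈ V, ∑ i : Fin (D.N v), ⟪WithLp.toLp 2 x, D.act v i⟫ ^ 2 :=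
    Finset.sum_nonneg fun _ _ => Finset.sum_nonneg fun _ _ => sq_nonneg _
  positivity

theorem trace_gram_le {lam : ℝ} (V : Finset (Fin U)) (hact : ∀ v i, ‖D.act v i‖ ≤ 1) :
    (D.gram lam V).trace ≤ lam * d + sampleCount D.N V := by
  have h1 : (D.gram lam V).trace
      = lam * d + ∑ v ∈ V, ∑ i : Fin (D.N v), ‖D.act v i‖ ^ 2 := by
    simp only [gram, Matrix.trace_add, Matrix.trace_smul, Matrix.trace_one, Matrix.trace_sum,
      Matrix.trace_vecMulVec, dotProduct_ofLp_self, Fintype.card_fin, smul_eq_mul]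
  rw [h1, sampleCount, Nat.cast_sum]
  gcongr with v hv
  calc _ ≤ ∑ i : Fin (D.N v), (1 : ℝ) :=
        Finset.sum_le_sum fun i _ => pow_le_one₀ (norm_nonneg _) (hact v i)
    _ = _ := by simp

/-- The noise part `∑ (r - ⟨θ, a⟩) a` of the pooled moment vector. -/
noncomputable def noise (θ : Vec d) (V : Finset (Fin U)) : Fin d → ℝ :=
  ∑ v ∈ V, ∑ i : Fin (D.N v), (D.rew v i - ⟪θ, D.act v i⟫) • (D.act v i).ofLp

theorem gram_mulVec_ridge_sub {lam : ℝ} (hlam : 0 < lam) (θ : Vec d) (V : Finset (Fin U)) :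
    D.gram lam V *ᵥ (D.ridge lam V - θ).ofLp = D.noise θ V - lam • θ.ofLp := by
  rw [WithLp.ofLp_sub, Matrix.mulVec_sub, D.gram_mulVec lam V θ, ridge]
  simp only
  rw [Matrix.mulVec_mulVec,
    Matrix.mul_nonsing_inv _ (by simpa using (D.gram_posDef hlam V).det_pos.ne'),
    Matrix.one_mulVec, moment, noise]
  simp only [sub_smul, Finset.sum_sub_distrib]
  abel

variable {D}

/-- The error is `M⁻¹ (noise - λ θ)`. Cauchy–Schwarz in the `M⁻¹` form treats both terms; since `M ≥
λ I` and `‖θ‖ ≤ 1`, the regularization bias contributes at most `λ · √λ⁻¹ = √λ`. -/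
theorem inner_ridge_sub_le {lam : ℝ} (hlam : 0 < lam) {θ : Vec d} (hθ : ‖θ‖ ≤ 1)
    {V : Finset (Fin U)} {c : ℝ}
    (hc : D.noise θ V ⬝ᵥ ((D.gram lam V)⁻¹ *ᵥ D.noise θ V) ≤ c) (b : Vec d) :
    ⟪D.ridge lam V - θ, b⟫
      ≤ (√c + √lam) * √(b.ofLp ⬝ᵥ ((D.gram lam V)⁻¹ *ᵥ b.ofLp)) := by
  have hM := D.gram_posDef hlam V
  have hI := hM.inv.posSemidef
  set M := D.gram lam V with hMdef
  have hsol : (D.ridge lam V - θ).ofLp = M⁻¹ *ᵥ (D.noise θ V - lam • θ.ofLp) := by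
    rw [← gram_mulVec_ridge_sub D hlam, Matrix.mulVec_mulVec,
      Matrix.nonsing_inv_mul _ (by simpa using hM.det_pos.ne'), Matrix.one_mulVec]
  have hθ2 : (-θ).ofLp ⬝ᵥ (M⁻¹ *ᵥ (-θ).ofLp) ≤ lam⁻¹ := by
    refine (dotProduct_inv_mulVec_le hM hlam (fun x => ?_) _).trans ?_
    · have h := D.dotProduct_gram_mulVec lam V (WithLp.toLp 2 x)
      have h3 := dotProduct_ofLp_self (WithLp.toLp 2 x)
      simp only at h h3
      rw [h, h3]
      exact le_add_of_nonneg_right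
        (Finset.sum_nonneg fun _ _ => Finset.sum_nonneg fun _ _ => sq_nonneg _)
    · rw [dotProduct_ofLp_self, norm_neg, div_eq_mul_inv]
      exact mul_le_of_le_one_left (by positivity) (pow_le_one₀ (norm_nonneg _) hθ)
  rw [real_inner_comm, ← dotProduct_ofLp, hsol]
  have h1 := dotProduct_mulVec_le_sqrt_mul_sqrt hI b.ofLp (D.noise θ V)
  have h2 := dotProduct_mulVec_le_sqrt_mul_sqrt hI b.ofLp (-θ).ofLp
  have h3 : b.ofLp ⬝ᵥ (M⁻¹ *ᵥ (D.noise θ V - lam • θ.ofLp))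
      = b.ofLp ⬝ᵥ (M⁻¹ *ᵥ D.noise θ V) + lam * (b.ofLp ⬝ᵥ (M⁻¹ *ᵥ (-θ).ofLp)) := by
    rw [WithLp.ofLp_neg, Matrix.mulVec_sub, Matrix.mulVec_smul, Matrix.mulVec_neg,
      dotProduct_sub, dotProduct_smul, dotProduct_neg, smul_eq_mul]
    ring
  set q := √(b.ofLp ⬝ᵥ (M⁻¹ *ᵥ b.ofLp)) with hq
  have hq0 : 0 ≤ q := Real.sqrt_nonneg _
  have h4 := Real.sqrt_le_sqrt hc
  have h5 := Real.sqrt_le_sqrt hθ2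
  have h6 : lam * √lam⁻¹ = √lam := by
    rw [Real.sqrt_inv, ← div_eq_mul_inv, Real.div_sqrt]
  rw [h3]
  calc _ ≤ q * √c + lam * (q * √lam⁻¹) := by
        gcongr
        · exact h1.trans (by gcongr)
        · exact h2.trans (by gcongr)
    _ = q * √c + q * (lam * √lam⁻¹) := by ring
    _ = _ := by rw [h6]; ring

theorem sqrt_dotProduct_gram_inv_le {lam m : ℝ} (hlam : 0 < lam) (hm : 0 < m)
    {V : Finset (Fin U)}
    (h : ∀ x : Vec d, m * ‖x‖ ^ 2 ≤ x.ofLp ⬝ᵥ (D.gram lam V *ᵥ x.ofLp)) (b : Vec d) :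
    √(b.ofLp ⬝ᵥ ((D.gram lam V)⁻¹ *ᵥ b.ofLp)) ≤ ‖b‖ / √m := by
  have h1 := dotProduct_inv_mulVec_le (D.gram_posDef hlam V) hm (fun x => by
    have h2 := h (WithLp.toLp 2 x)
    rwa [← dotProduct_ofLp_self] at h2) b.ofLp
  rw [dotProduct_ofLp_self] at h1
  refine (Real.sqrt_le_sqrt h1).trans ?_
  rw [Real.sqrt_div (sq_nonneg _), Real.sqrt_sq (norm_nonneg _)]

/-- The directional bound is tested on the error itself and divided by its norm. -/
theorem norm_ridge_sub_le {lam m c : ℝ} (hlam : 0 < lam) (hm : 0 < m) {θ : Vec d} (hθ : ‖θ‖ ≤ 1)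
    {V : Finset (Fin U)}
    (hc : D.noise θ V ⬝ᵥ ((D.gram lam V)⁻¹ *ᵥ D.noise θ V) ≤ c)
    (h : ∀ x : Vec d, m * ‖x‖ ^ 2 ≤ x.ofLp ⬝ᵥ (D.gram lam V *ᵥ x.ofLp)) :
    ‖D.ridge lam V - θ‖ ≤ (√c + √lam) / √m := by
  have h1 := inner_ridge_sub_le hlam hθ hc (D.ridge lam V - θ)
  have h2 := sqrt_dotProduct_gram_inv_le hlam hm h (D.ridge lam V - θ)
  rw [real_inner_self_eq_norm_sq] at h1
  rcases (norm_nonneg (D.ridge lam V - θ)).eq_or_lt with h0 | h0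
  · rw [← h0]; positivity
  · refine le_of_mul_le_mul_right ?_ h0
    calc _ = ‖D.ridge lam V - θ‖ ^ 2 := by ring
      _ ≤ _ := h1.trans (mul_le_mul_of_nonneg_left h2 (by positivity))
      _ = _ := by ring

end Dataset

/-! ### Gaussian integrals with a quadratic exponent -/

section GaussianIntegral

variable {n : Type*} [Fintype n]

variable (n) in
/-- The total mass of the unnormalized standard Gaussian density. -/
noncomputable def gaussianMass : ENNReal :=
  ∫⁻ x : n → ℝ, ENNReal.ofReal (Real.exp (-(x ⬝ᵥ x) / 2))

theorem gaussianMass_ne_top : gaussianMass n ≠ ⊤ := by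
  have h : Integrable (fun x : n → ℝ => ∏ i, Real.exp (-(1 / 2) * x i ^ 2)) :=
    Integrable.fintype_prod fun i => integrable_exp_neg_mul_sq (by norm_num)
  have h2 : (fun x : n → ℝ => ∏ i, Real.exp (-(1 / 2) * x i ^ 2))
      = fun x => Real.exp (-(x ⬝ᵥ x) / 2) := by
    ext x
    rw [← Real.exp_sum, dotProduct, ← Finset.mul_sum]
    congr 1
    simp only [sq]
    ring
  rw [h2] at h
  exact h.lintegral_lt_top.ne

theorem gaussianMass_ne_zero : gaussianMass n ≠ 0 := by
  have hm : Measurable fun x : n → ℝ => ENNReal.ofReal (Real.exp (-(x ⬝ᵥ x) / 2)) := by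
    unfold dotProduct; fun_prop
  rw [gaussianMass, Ne, lintegral_eq_zero_iff hm]
  intro h
  have h2 : ∀ᵐ x : n → ℝ, False := h.mono fun x hx => by
    simp only [Pi.zero_apply, ENNReal.ofReal_eq_zero] at hx
    exact absurd hx (not_le.2 (Real.exp_pos _))
  rw [Filter.eventually_false_iff_eq_bot, ae_eq_bot] at h2
  exact NeZero.ne (volume : Measure (n → ℝ)) h2

/-- Completing the square at `y = M⁻¹ s` and substituting `x ↦ C (x - y)` with `M = Cᵀ C`, whose
Jacobian is `|det C| = √(det M)`. The common factor `gaussianMass` is never evaluated, since it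
cancels later. -/
theorem lintegral_exp_quadratic [DecidableEq n] {M : Matrix n n ℝ} (hM : M.PosDef) (s : n → ℝ) :
    ∫⁻ x : n → ℝ, ENNReal.ofReal (Real.exp (s ⬝ᵥ x - x ⬝ᵥ (M *ᵥ x) / 2))
      = ENNReal.ofReal (Real.exp (s ⬝ᵥ (M⁻¹ *ᵥ s) / 2) / √M.det) * gaussianMass n := by
  obtain ⟨C, hC⟩ := exists_transpose_mul_self hM.posSemidef
  have hdet : M.det = C.det ^ 2 := by rw [hC, Matrix.det_mul, Matrix.det_transpose, sq]
  have hC0 : C.det ≠ 0 := by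
    intro h
    have := hM.det_pos
    rw [hdet, h] at this
    simp at this
  have hsq : √M.det = |C.det| := by rw [hdet, Real.sqrt_sq_eq_abs]
  set y := M⁻¹ *ᵥ s with hy
  have hMy : M *ᵥ y = s := by
    rw [hy, Matrix.mulVec_mulVec, Matrix.mul_nonsing_inv _ (by simpa using hM.det_pos.ne'),
      Matrix.one_mulVec]
  have hsymm : ∀ u v : n → ℝ, u ⬝ᵥ (M *ᵥ v) = v ⬝ᵥ (M *ᵥ u) := fun u v => by
    rw [hC, dotProduct_transpose_mul_self, dotProduct_transpose_mul_self, dotProduct_comm]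
  set f : (n → ℝ) → ENNReal := fun x => ENNReal.ofReal (Real.exp (-(x ⬝ᵥ x) / 2)) with hf
  have hfm : Measurable f := by
    simp only [hf, dotProduct]; fun_prop
  have key : ∀ x : n → ℝ, ENNReal.ofReal (Real.exp (s ⬝ᵥ x - x ⬝ᵥ (M *ᵥ x) / 2))
      = ENNReal.ofReal (Real.exp (s ⬝ᵥ y / 2)) * f (C *ᵥ (x - y)) := fun x => by
    rw [hf, ← ENNReal.ofReal_mul (Real.exp_pos _).le, ← Real.exp_add]
    congr 2
    rw [← dotProduct_transpose_mul_self, ← hC]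
    simp only [Matrix.mulVec_sub, dotProduct_sub, sub_dotProduct, hMy]
    rw [hsymm y x, hMy, dotProduct_comm y s, dotProduct_comm x s]
    ring
  simp_rw [key]
  have hCm : Measurable fun x : n → ℝ => C *ᵥ x :=
    (Continuous.matrix_mulVec continuous_const continuous_id).measurable
  rw [lintegral_const_mul _ (by fun_prop),
    lintegral_sub_right_eq_self (fun x => f (C *ᵥ x)) y]
  have hmap := Real.map_matrix_volume_pi_eq_smul_volume_pi hC0
  have h1 : ∫⁻ x : n → ℝ, f (C *ᵥ x) = ENNReal.ofReal |C.det⁻¹| * gaussianMass n := by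
    have h2 := lintegral_map (μ := volume) hfm (g := ⇑(Matrix.toLin' C)) hCm
    rw [hmap, lintegral_smul_measure] at h2
    simpa [gaussianMass, hf] using h2.symm
  rw [h1, ← mul_assoc, ← ENNReal.ofReal_mul (Real.exp_pos _).le, hsq, abs_inv, ← div_eq_mul_inv]

end GaussianIntegral

/-! ### Exponential supermartingales with predictable multipliers -/

section Supermartingale

variable {Ω : Type*} {m m0 : MeasurableSpace Ω} {P : Measure Ω} [IsProbabilityMeasure P]

/-- The conditional bound says that, restricted to `m`, the measure with density `exp (s η - s²/2)`
is dominated by `P`. Integrating an `m`-measurable `W` against both measures needs no integrability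
of `W`. -/
theorem lintegral_mul_exp_const_le (hm : m ≤ m0) {η : Ω → ℝ} (hη : Measurable η) (s : ℝ)
    (hint : Integrable (fun ω => Real.exp (s * η ω)) P)
    (hsub : P[fun ω => Real.exp (s * η ω) | m] ≤ᵐ[P] fun _ => Real.exp (s ^ 2 / 2))
    {W : Ω → ENNReal} (hW : Measurable[m] W) :
    ∫⁻ ω, W ω * ENNReal.ofReal (Real.exp (s * η ω - s ^ 2 / 2)) ∂P ≤ ∫⁻ ω, W ω ∂P := by
  set g : Ω → ENNReal := fun ω => ENNReal.ofReal (Real.exp (s * η ω - s ^ 2 / 2)) with hg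
  have hgm : Measurable g := by fun_prop
  have hle : (P.withDensity g).trim hm ≤ P.trim hm := by
    refine Measure.le_iff.2 fun A hA => ?_
    rw [trim_measurableSet_eq hm hA, trim_measurableSet_eq hm hA, withDensity_apply _ (hm _ hA)]
    have h1 : ∫ ω in A, Real.exp (s * η ω) ∂P ≤ Real.exp (s ^ 2 / 2) * P.real A := by
      rw [← setIntegral_condExp hm hint hA]
      calc _ ≤ ∫ ω in A, Real.exp (s ^ 2 / 2) ∂P :=
            integral_mono_ae integrable_condExp.integrableOn (integrable_const _)
              (ae_restrict_of_ae hsub)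
        _ = _ := by simp [mul_comm]
    have h2 : ∫⁻ ω in A, g ω ∂P
        = ENNReal.ofReal (∫ ω in A, Real.exp (s * η ω - s ^ 2 / 2) ∂P) := by
      rw [ofReal_integral_eq_lintegral_ofReal]
      · simp_rw [Real.exp_sub]
        exact (hint.div_const _).integrableOn
      · exact ae_of_all _ fun _ => (Real.exp_pos _).le
    rw [h2, ← ofReal_measureReal]
    refine ENNReal.ofReal_le_ofReal ?_
    simp_rw [Real.exp_sub]
    rw [integral_div, div_le_iff₀ (Real.exp_pos _), mul_comm]
    exact h1
  calc ∫⁻ ω, W ω * g ω ∂P = ∫⁻ ω, W ω ∂(P.withDensity g) := by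
        rw [lintegral_withDensity_eq_lintegral_mul _ hgm (hW.mono hm le_rfl)]
        simp [mul_comm]
    _ = ∫⁻ ω, W ω ∂((P.withDensity g).trim hm) := (lintegral_trim hm hW).symm
    _ ≤ ∫⁻ ω, W ω ∂(P.trim hm) := lintegral_mono' hle le_rfl
    _ = _ := lintegral_trim hm hW

/-- The conditional sub-Gaussian bound for deterministic parameters extends to random parameters
that are measurable with respect to the conditioning σ-algebra. -/
theorem lintegral_mul_exp_le (hm : m ≤ m0) {η : Ω → ℝ} (hη : Measurable η)
    (hint : ∀ s : ℝ, Integrable (fun ω => Real.exp (s * η ω)) P)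
    (hsub : ∀ s : ℝ, P[fun ω => Real.exp (s * η ω) | m] ≤ᵐ[P] fun _ => Real.exp (s ^ 2 / 2))
    {W : Ω → ENNReal} (hW : Measurable[m] W) {s : Ω → ℝ} (hs : Measurable[m] s) :
    ∫⁻ ω, W ω * ENNReal.ofReal (Real.exp (s ω * η ω - s ω ^ 2 / 2)) ∂P ≤ ∫⁻ ω, W ω ∂P := by
  have hW0 : Measurable W := hW.mono hm le_rfl
  -- A multiplier with finite range is constant on each of its level sets, which belong to `m` and
  -- can be absorbed into `W`. Fatou's lemma then passes to general `s`.
  have hsimple : ∀ t : Ω → ℝ, Measurable[m] t → (Set.range t).Finite →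
      ∫⁻ ω, W ω * ENNReal.ofReal (Real.exp (t ω * η ω - t ω ^ 2 / 2)) ∂P ≤ ∫⁻ ω, W ω ∂P := by
    intro t htm hfin
    have hmeas : ∀ c, MeasurableSet[m] (t ⁻¹' {c}) := fun c => htm (measurableSet_singleton c)
    have hsplit : ∀ (F : ℝ → Ω → ENNReal) ω, W ω * F (t ω) ω
        = ∑ c ∈ hfin.toFinset, (t ⁻¹' {c}).indicator W ω * F c ω := by
      intro F ω
      rw [Finset.sum_eq_single (t ω)]
      · simp
      · intro c _ hc
        rw [Set.indicator_of_notMem (by simpa using fun h => hc h.symm), zero_mul]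
      · intro h
        exact absurd (by simp) h
    calc ∫⁻ ω, W ω * ENNReal.ofReal (Real.exp (t ω * η ω - t ω ^ 2 / 2)) ∂P
        = ∑ c ∈ hfin.toFinset, ∫⁻ ω, (t ⁻¹' {c}).indicator W ω
            * ENNReal.ofReal (Real.exp (c * η ω - c ^ 2 / 2)) ∂P := by
          rw [← lintegral_finsetSum]
          · exact lintegral_congr fun ω =>
              hsplit (fun c ω => ENNReal.ofReal (Real.exp (c * η ω - c ^ 2 / 2))) ω
          · intro c _
            exact (hW0.indicator (hm _ (hmeas c))).mul (by fun_prop)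
      _ ≤ ∑ c ∈ hfin.toFinset, ∫⁻ ω, (t ⁻¹' {c}).indicator W ω ∂P :=
          Finset.sum_le_sum fun c _ =>
            lintegral_mul_exp_const_le hm hη c (hint c) (hsub c) (hW.indicator (hmeas c))
      _ = ∫⁻ ω, W ω ∂P := by
          rw [← lintegral_finsetSum]
          · refine lintegral_congr fun ω => ?_
            simpa using (hsplit (fun _ _ => 1) ω).symm
          · intro c _
            exact hW0.indicator (hm _ (hmeas c))
  have hsm : StronglyMeasurable[m] s := hs.stronglyMeasurable
  have happ : ∀ k, Measurable[m] fun ω => hsm.approx k ω := fun k =>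
    @SimpleFunc.measurable Ω ℝ m _ (hsm.approx k)
  have htend : ∀ ω, Filter.Tendsto (fun k => W ω * ENNReal.ofReal
      (Real.exp (hsm.approx k ω * η ω - hsm.approx k ω ^ 2 / 2))) Filter.atTop
      (nhds (W ω * ENNReal.ofReal (Real.exp (s ω * η ω - s ω ^ 2 / 2)))) := by
    intro ω
    have h := hsm.tendsto_approx ω
    refine ENNReal.Tendsto.const_mul ?_ (Or.inl ?_)
    · refine ENNReal.tendsto_ofReal ((Real.continuous_exp.tendsto _).comp ?_)
      exact (h.mul_const _).sub ((h.pow 2).div_const _)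
    · simpa using Real.exp_pos _
  calc _ = ∫⁻ ω, Filter.liminf (fun k => W ω * ENNReal.ofReal
        (Real.exp (hsm.approx k ω * η ω - hsm.approx k ω ^ 2 / 2))) Filter.atTop ∂P :=
        lintegral_congr fun ω => (htend ω).liminf_eq.symm
    _ ≤ Filter.liminf (fun k => ∫⁻ ω, W ω * ENNReal.ofReal
        (Real.exp (hsm.approx k ω * η ω - hsm.approx k ω ^ 2 / 2)) ∂P) Filter.atTop := by
        refine lintegral_liminf_le fun k => ?_
        have : Measurable fun ω => hsm.approx k ω := (happ k).mono hm le_rfl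
        fun_prop
    _ ≤ Filter.liminf (fun _ : ℕ => ∫⁻ ω, W ω ∂P) Filter.atTop :=
        Filter.liminf_le_liminf (Filter.Eventually.of_forall fun k =>
          hsimple _ (happ k) (@SimpleFunc.finite_range Ω ℝ m (hsm.approx k)))
    _ = _ := Filter.liminf_const _

/-- The exponential process built from predictable multipliers `s p` and conditionally
sub-Gaussian noise `η p`, drawn at distinct times, has expectation at most one. -/
theorem lintegral_prod_exp_le_one {ι : Type*} (ℱ : Filtration ℕ m0)
    (V : Finset ι) {t : ι → ℕ} (ht : Function.Injective t) {s η : ι → Ω → ℝ}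
    (hs : ∀ p, Measurable[ℱ (t p)] (s p)) (hη : ∀ p, Measurable[ℱ (t p + 1)] (η p))
    (hint : ∀ p (c : ℝ), Integrable (fun ω => Real.exp (c * η p ω)) P)
    (hsub : ∀ p (c : ℝ), P[fun ω => Real.exp (c * η p ω) | ℱ (t p)]
      ≤ᵐ[P] fun _ => Real.exp (c ^ 2 / 2)) :
    ∫⁻ ω, ∏ p ∈ V, ENNReal.ofReal (Real.exp (s p ω * η p ω - s p ω ^ 2 / 2)) ∂P ≤ 1 := by
  classical
  set F : ι → Ω → ENNReal := fun p ω =>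
    ENNReal.ofReal (Real.exp (s p ω * η p ω - s p ω ^ 2 / 2)) with hF
  have hFm : ∀ p, Measurable[ℱ (t p + 1)] (F p) := fun p => by
    have h1 : Measurable[ℱ (t p + 1)] (s p) :=
      (hs p).mono (ℱ.mono (Nat.le_succ _)) le_rfl
    have h2 := hη p
    simp only [hF]
    exact ENNReal.measurable_ofReal.comp (Real.measurable_exp.comp
      ((h1.mul h2).sub ((h1.pow_const 2).div_const 2)))
  -- Induction over time: all factors drawn before `k` are `ℱ k`-measurable, and by injectivity of
  -- `t` at most one factor is drawn at time `k`.
  have key : ∀ k : ℕ, ∫⁻ ω, ∏ p ∈ V with t p < k, F p ω ∂P ≤ 1 := by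
    intro k
    induction k with
    | zero => simp
    | succ k ih =>
      have hprod : Measurable[ℱ k] fun ω => ∏ p ∈ V with t p < k, F p ω := by
        refine Finset.measurable_prod _ fun p hp => ?_
        exact (hFm p).mono (ℱ.mono (Finset.mem_filter.1 hp).2) le_rfl
      by_cases hk : ∃ q ∈ V, t q = k
      · obtain ⟨q, hqV, hq⟩ := hk
        have hset : (V.filter fun p => t p < k + 1) = insert q (V.filter fun p => t p < k) := by
          ext p
          simp only [Finset.mem_filter, Finset.mem_insert]
          constructor
          · rintro ⟨hp, hpk⟩
            rcases (Nat.lt_succ_iff.1 hpk).eq_or_lt with h | h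
            · exact Or.inl (ht (h.trans hq.symm))
            · exact Or.inr ⟨hp, h⟩
          · rintro (rfl | ⟨hp, hpk⟩)
            · exact ⟨hqV, by omega⟩
            · exact ⟨hp, by omega⟩
        have hnot : q ∉ V.filter fun p => t p < k := by simp [hq]
        have hq1 : ∫⁻ ω, ∏ p ∈ V with t p < k + 1, F p ω ∂P
            = ∫⁻ ω, (∏ p ∈ V with t p < k, F p ω) * F q ω ∂P :=
          lintegral_congr fun ω => by rw [hset, Finset.prod_insert hnot, mul_comm]
        rw [hq1]
        subst hq
        exact (lintegral_mul_exp_le (ℱ.le _) ((hη q).mono (ℱ.le _) le_rfl) (hint q) (hsub q)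
          hprod (hs q)).trans ih
      · push Not at hk
        have hset : (V.filter fun p => t p < k + 1) = V.filter fun p => t p < k := by
          refine Finset.filter_congr fun p hp => ?_
          have := hk p hp
          omega
        rwa [hset]
  have hall : (V.filter fun p => t p < V.sup t + 1) = V :=
    Finset.filter_true_of_mem fun p hp => Nat.lt_succ_of_le (Finset.le_sup hp)
  have h := key (V.sup t + 1)
  rwa [hall] at h

end Supermartingale

/-! ### Self-normalized concentration by the method of mixtures -/

namespace OfflineData

variable {Ω : Type*} [mΩ : MeasurableSpace Ω] {P : Measure Ω}
  {U d : ℕ} {θ : Fin U → Vec d} {ρ : Measure (Vec d)} {S : ℕ} (X : OfflineData P θ ρ S)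

theorem measurable_act (u : Fin U) (i : Fin (X.N u)) : Measurable (X.act u i) :=
  (X.act_measurable u i).mono (X.ℱ.le _) le_rfl

theorem measurable_rew (u : Fin U) (i : Fin (X.N u)) : Measurable (X.rew u i) :=
  (X.rew_measurable u i).mono (X.ℱ.le _) le_rfl

theorem ae_norm_act_le (hρ : ∀ᵐ a ∂ρ, ‖a‖ ≤ 1) : ∀ᵐ ω ∂P, ∀ u i, ‖X.act u i ω‖ ≤ 1 := by
  have hc : ∀ᵐ ω ∂P, ∀ u i j, ‖X.cand u i j ω‖ ≤ 1 := by
    simp only [ae_all_iff]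
    intro u i j
    have h := hρ
    rw [← X.cand_law u i j] at h
    exact ae_of_ae_map (X.cand_measurable u i j).aemeasurable h
  have ha : ∀ᵐ ω ∂P, ∀ u i, ∃ j, X.act u i ω = X.cand u i j ω := by
    simp only [ae_all_iff]
    exact X.act_mem
  filter_upwards [hc, ha] with ω h1 h2 u i
  obtain ⟨j, hj⟩ := h2 u i
  rw [hj]
  exact h1 u i j

theorem measurable_noise_sub (p : (u : Fin U) × Fin (X.N u)) :
    Measurable[X.ℱ (X.time p + 1)] fun ω => X.rew p.1 p.2 ω - ⟪θ p.1, X.act p.1 p.2 ω⟫ := by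
  have h1 : Measurable[X.ℱ (X.time p + 1)] (X.act p.1 p.2) :=
    (X.act_measurable p.1 p.2).mono (X.ℱ.mono (Nat.le_succ _)) le_rfl
  exact (X.rew_measurable p.1 p.2).sub ((measurable_const.inner measurable_id).comp h1)

theorem noise_dataset (θ₀ : Vec d) (V : Finset (Fin U)) (ω : Ω) :
    (X.dataset ω).noise θ₀ V = ∑ v ∈ V, ∑ i : Fin (X.N v),
      (X.rew v i ω - ⟪θ₀, X.act v i ω⟫) • (X.act v i ω).ofLp := rfl

theorem dotProduct_gram_dataset (lam : ℝ) (V : Finset (Fin U)) (ω : Ω) (x : Vec d) :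
    x.ofLp ⬝ᵥ ((X.dataset ω).gram lam V *ᵥ x.ofLp) = lam * ‖x‖ ^ 2
      + ∑ v ∈ V, ∑ i : Fin (X.N v), ⟪x, X.act v i ω⟫ ^ 2 :=
  (X.dataset ω).dotProduct_gram_mulVec lam V x

/-- The exponential process with multipliers `⟪x, a⟫`. Users with a common preference vector can be
pooled because their noise terms refer to the same `θ₀`. -/
theorem lintegral_exp_noise_le [IsProbabilityMeasure P] {θ₀ : Vec d} {V : Finset (Fin U)} (hV : ∀ v ∈ V, θ v = θ₀)
    (x : Vec d) :
    ∫⁻ ω, ENNReal.ofReal (Real.exp ((X.dataset ω).noise θ₀ V ⬝ᵥ x.ofLp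
      - (∑ v ∈ V, ∑ i, ⟪x, X.act v i ω⟫ ^ 2) / 2)) ∂P ≤ 1 := by
  have h := lintegral_prod_exp_le_one (P := P) X.ℱ (V.sigma fun v => Finset.univ)
    X.time_injective (s := fun p ω => ⟪x, X.act p.1 p.2 ω⟫)
    (η := fun p ω => X.rew p.1 p.2 ω - ⟪θ p.1, X.act p.1 p.2 ω⟫)
    (fun p => (measurable_const.inner measurable_id).comp (X.act_measurable p.1 p.2))
    X.measurable_noise_sub (fun p c => X.noise_integrable p.1 p.2 c)
    (fun p c => X.noise_subgaussian p.1 p.2 c)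
  refine le_of_eq_of_le (lintegral_congr fun ω => ?_) h
  rw [← ENNReal.ofReal_prod_of_nonneg (fun _ _ => (Real.exp_pos _).le), ← Real.exp_sum]
  congr 2
  rw [Finset.sum_sigma]
  simp only [noise_dataset, sum_dotProduct, smul_dotProduct, Finset.sum_sub_distrib,
    Finset.sum_div]
  congr 1
  refine Finset.sum_congr rfl fun v hv => Finset.sum_congr rfl fun i _ => ?_
  rw [Dataset.dotProduct_ofLp, hV v hv, real_inner_comm x, smul_eq_mul, mul_comm]

theorem measurable_noise_dotProduct (θ₀ : Vec d) (V : Finset (Fin U)) :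
    Measurable fun p : Ω × (Fin d → ℝ) => (X.dataset p.1).noise θ₀ V ⬝ᵥ p.2 := by
  simp only [noise_dataset, sum_dotProduct, smul_dotProduct, smul_eq_mul]
  refine Finset.measurable_fun_sum _ fun v _ => Finset.measurable_fun_sum _ fun i _ => ?_
  have h1 : Measurable fun p : Ω × (Fin d → ℝ) => X.act v i p.1 :=
    (X.measurable_act v i).comp measurable_fst
  have h2 : Measurable fun p : Ω × (Fin d → ℝ) => X.rew v i p.1 :=
    (X.measurable_rew v i).comp measurable_fst
  refine (h2.sub (measurable_const.inner h1)).mul ?_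
  simp only [dotProduct]
  refine Finset.measurable_fun_sum _ fun k _ => Measurable.mul ?_ ?_
  · exact (measurable_pi_apply k).comp ((PiLp.continuous_ofLp 2 _).measurable.comp h1)
  · exact (measurable_pi_apply k).comp measurable_snd

/-- Mixing the exponential supermartingales over a Gaussian prior. -/
theorem lintegral_exp_noise_mixture_le [IsProbabilityMeasure P] {lam : ℝ} (hlam : 0 < lam) {θ₀ : Vec d}
    {V : Finset (Fin U)} (hV : ∀ v ∈ V, θ v = θ₀) :
    (∫⁻ ω, ENNReal.ofReal (Real.exp ((X.dataset ω).noise θ₀ V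
        ⬝ᵥ (((X.dataset ω).gram lam V)⁻¹ *ᵥ (X.dataset ω).noise θ₀ V) / 2)
      / √((X.dataset ω).gram lam V).det) ∂P) ≤ ENNReal.ofReal (1 / √(lam ^ d))
    ∧ AEMeasurable (fun ω => ENNReal.ofReal (Real.exp ((X.dataset ω).noise θ₀ V
        ⬝ᵥ (((X.dataset ω).gram lam V)⁻¹ *ᵥ (X.dataset ω).noise θ₀ V) / 2)
      / √((X.dataset ω).gram lam V).det)) P := by
  set G := gaussianMass (Fin d)
  have hG0 : G ≠ 0 := gaussianMass_ne_zero
  have hGt : G ≠ ⊤ := gaussianMass_ne_top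
  set f : Ω → ENNReal := fun ω => ENNReal.ofReal (Real.exp ((X.dataset ω).noise θ₀ V
        ⬝ᵥ (((X.dataset ω).gram lam V)⁻¹ *ᵥ (X.dataset ω).noise θ₀ V) / 2)
      / √((X.dataset ω).gram lam V).det) with hf
  set g : Ω → (Fin d → ℝ) → ENNReal := fun ω x =>
    ENNReal.ofReal (Real.exp ((X.dataset ω).noise θ₀ V ⬝ᵥ x
      - (∑ v ∈ V, ∑ i, ⟪WithLp.toLp 2 x, X.act v i ω⟫ ^ 2) / 2)) with hg
  set h : (Fin d → ℝ) → ENNReal := fun x => ENNReal.ofReal (Real.exp (-(lam * (x ⬝ᵥ x)) / 2))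
    with hh
  have hgm : Measurable (Function.uncurry g) := by
    refine ENNReal.measurable_ofReal.comp (Real.measurable_exp.comp
      ((X.measurable_noise_dotProduct θ₀ V).sub ?_))
    refine (Finset.measurable_sum _ fun v _ => Finset.measurable_sum _ fun i _ => ?_).div_const _
    have h1 := X.measurable_act v i
    have h2 : Measurable fun p : Ω × (Fin d → ℝ) => WithLp.toLp 2 p.2 :=
      (PiLp.continuous_toLp 2 _).measurable.comp measurable_snd
    exact (h2.inner (h1.comp measurable_fst)).pow_const 2
  have hg1 : ∀ x, ∫⁻ ω, g ω x ∂P ≤ 1 := fun x =>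
    X.lintegral_exp_noise_le hV (WithLp.toLp 2 x)
  have hhm : Measurable h := by simp only [hh, dotProduct]; fun_prop
  have hF : Measurable (Function.uncurry fun ω x => g ω x * h x) :=
    hgm.mul (hhm.comp measurable_snd)
  -- The prior exponent `λ |x|²/2` completes the sum of squares in `g` to the quadratic form of the
  -- regularized Gram matrix.
  have hfg : ∀ ω, f ω * G = ∫⁻ x, g ω x * h x := by
    intro ω
    rw [hf, ← lintegral_exp_quadratic ((X.dataset ω).gram_posDef hlam V)]
    refine lintegral_congr fun x => ?_
    rw [hg, hh, ← ENNReal.ofReal_mul (Real.exp_pos _).le, ← Real.exp_add]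
    congr 2
    have h1 := X.dotProduct_gram_dataset lam V ω (WithLp.toLp 2 x)
    rw [← Dataset.dotProduct_ofLp_self] at h1
    simp only at h1
    rw [h1]
    ring
  have hprior : ∫⁻ x, h x = ENNReal.ofReal (1 / √(lam ^ d)) * G := by
    have hpd : (lam • (1 : Matrix (Fin d) (Fin d) ℝ)).PosDef := Matrix.PosDef.one.smul hlam
    have h1 := lintegral_exp_quadratic hpd 0
    simp only [zero_dotProduct, zero_div, Real.exp_zero, Matrix.det_smul, Matrix.det_one,
      Fintype.card_fin, mul_one, Matrix.smul_mulVec, Matrix.one_mulVec, dotProduct_smul,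
      smul_eq_mul, zero_sub] at h1
    rw [← h1, hh]
    simp only [neg_div]
  clear_value f g h
  -- Expressing `f` as an integral over `x` also yields its measurability, without treating the
  -- inverse matrix and the determinant directly.
  have hcancel : ∀ ω, f ω = (∫⁻ x, g ω x * h x) * G⁻¹ := fun ω => by
    rw [← hfg, mul_assoc, ENNReal.mul_inv_cancel hG0 hGt, mul_one]
  have hfm : Measurable f := by
    rw [funext hcancel]
    exact (Measurable.lintegral_prod_right hF).mul_const _
  refine ⟨?_, hfm.aemeasurable⟩
  have hmain : (∫⁻ ω, f ω ∂P) * G ≤ ENNReal.ofReal (1 / √(lam ^ d)) * G := by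
    rw [← lintegral_mul_const _ hfm]
    simp_rw [hfg]
    rw [lintegral_lintegral_swap hF.aemeasurable, ← hprior]
    refine lintegral_mono fun x => ?_
    have hgx : Measurable fun ω => g ω x := hgm.comp measurable_prodMk_right
    rw [lintegral_mul_const _ hgx]
    exact mul_le_of_le_one_left zero_le (hg1 x)
  exact (ENNReal.mul_le_mul_iff_left hG0 hGt).1 hmain

/-- Self-normalized concentration of the pooled noise at a fixed horizon. -/
theorem measure_noise_gt_le [IsProbabilityMeasure P] (hρ : ∀ᵐ a ∂ρ, ‖a‖ ≤ 1) (hd : 0 < d) {lam : ℝ} (hlam : 0 < lam)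
    {θ₀ : Vec d} {V : Finset (Fin U)} (hV : ∀ v ∈ V, θ v = θ₀) {ε : ℝ} (hε : 0 < ε) :
    P {ω | d * Real.log (1 + sampleCount X.N V / (lam * d)) + 2 * Real.log (1 / ε)
      < (X.dataset ω).noise θ₀ V
        ⬝ᵥ (((X.dataset ω).gram lam V)⁻¹ *ᵥ (X.dataset ω).noise θ₀ V)} ≤ ENNReal.ofReal ε := by
  obtain ⟨hint, hmeas⟩ := X.lintegral_exp_noise_mixture_le hlam hV
  set c : ℝ := 1 / √(lam ^ d) with hc
  have hc0 : 0 < c := by positivity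
  -- The mixture has expectation at most `c`, so the level `c / ε` is exceeded with probability at
  -- most `ε`.
  have hmark := meas_ge_le_lintegral_div hmeas (ε := ENNReal.ofReal (c / ε))
    (by simpa using by positivity) ENNReal.ofReal_ne_top
  have hle : (∫⁻ ω, ENNReal.ofReal (Real.exp ((X.dataset ω).noise θ₀ V
        ⬝ᵥ (((X.dataset ω).gram lam V)⁻¹ *ᵥ (X.dataset ω).noise θ₀ V) / 2)
      / √((X.dataset ω).gram lam V).det) ∂P) / ENNReal.ofReal (c / ε) ≤ ENNReal.ofReal ε := by
    refine ENNReal.div_le_of_le_mul (hint.trans_eq ?_)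
    rw [← ENNReal.ofReal_mul hε.le]
    congr 1
    field_simp
  refine le_trans (measure_mono_ae ?_) (hmark.trans hle)
  filter_upwards [X.ae_norm_act_le hρ] with ω hω hq
  change d * Real.log (1 + sampleCount X.N V / (lam * d)) + 2 * Real.log (1 / ε) < _ at hq
  change ENNReal.ofReal (c / ε) ≤ _
  set q := (X.dataset ω).noise θ₀ V
        ⬝ᵥ (((X.dataset ω).gram lam V)⁻¹ *ᵥ (X.dataset ω).noise θ₀ V)
  have : Nonempty (Fin d) := ⟨⟨0, hd⟩⟩
  have hd' : (0 : ℝ) < d := by exact_mod_cast hd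
  have hpos := (X.dataset ω).gram_posDef hlam V
  set D := ((X.dataset ω).gram lam V).det with hD
  have hD0 : 0 < D := hpos.det_pos
  have hdet : D ≤ lam ^ d * (1 + sampleCount X.N V / (lam * d)) ^ d := by
    have htr := (X.dataset ω).trace_gram_le (lam := lam) V hω
    have h1 := det_le_trace_div_card_pow hpos
    rw [Fintype.card_fin] at h1
    refine h1.trans ?_
    rw [← mul_pow]
    refine pow_le_pow_left₀ (div_nonneg hpos.posSemidef.trace_nonneg hd'.le) ?_ _
    rw [div_le_iff₀ hd']
    refine htr.trans_eq ?_
    have : (X.dataset ω).N = X.N := rfl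
    rw [this]
    field_simp
  set L : ℝ := 1 + sampleCount X.N V / (lam * d) with hL
  have hL0 : 0 < L := by positivity
  refine ENNReal.ofReal_le_ofReal ?_
  rw [hc, div_div, div_le_div_iff₀ (by positivity) (Real.sqrt_pos.2 hD0), one_mul]
  have h1 : √D ≤ √(lam ^ d) * √(L ^ d) := by
    rw [← Real.sqrt_mul (by positivity)]
    exact Real.sqrt_le_sqrt hdet
  have h2 : √(L ^ d) ≤ Real.exp (q / 2) * ε := by
    have h3 : √(L ^ d) = Real.exp (d * Real.log L / 2) := by
      rw [Real.exp_half, ← Real.log_pow, Real.exp_log (by positivity)]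
    have h4 : ε = Real.exp (-Real.log (1 / ε)) := by
      rw [one_div, Real.log_inv, neg_neg, Real.exp_log hε]
    rw [h3]
    conv_rhs => rw [h4]
    rw [← Real.exp_add]
    exact Real.exp_le_exp.2 (by linarith)
  calc √D ≤ √(lam ^ d) * (Real.exp (q / 2) * ε) := h1.trans (by gcongr)
    _ = _ := by ring

end OfflineData

/-! ### Finite nets of the unit sphere -/

section SphereNet

/-- Volume comparison: the balls of radius `ε/2` about the points are disjoint and lie in the ball
of radius `1 + ε/2`. -/
theorem card_le_of_separated_of_norm_le_one {d : ℕ} {ε : ℝ} (hε : 0 < ε) (s : Finset (Vec d))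
    (hs : ∀ c ∈ s, ‖c‖ ≤ 1) (h : ∀ c ∈ s, ∀ c' ∈ s, c ≠ c' → ε ≤ ‖c - c'‖) :
    (s.card : ℝ) ≤ (1 + 2 / ε) ^ d := by
  have hr : 0 < ε / 2 := by positivity
  have hR : 0 < 1 + ε / 2 := by positivity
  have hdisj : Set.Pairwise (s : Set (Vec d))
      (Function.onFun Disjoint fun c => Metric.ball (c : Vec d) (ε / 2)) := by
    intro c hc c' hc' hcc
    refine Metric.ball_disjoint_ball ?_
    rw [dist_eq_norm, add_halves]
    exact h c hc c' hc' hcc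
  have hsub : (⋃ c ∈ s, Metric.ball (c : Vec d) (ε / 2)) ⊆ Metric.ball 0 (1 + ε / 2) := by
    refine Set.iUnion₂_subset fun c hc => Metric.ball_subset_ball' ?_
    rw [dist_zero_right]
    linarith [hs c hc]
  have hvol : (s.card : ENNReal) * ENNReal.ofReal ((ε / 2) ^ d)
        * volume (Metric.ball (0 : Vec d) 1)
      ≤ ENNReal.ofReal ((1 + ε / 2) ^ d) * volume (Metric.ball (0 : Vec d) 1) := by
    calc _ = volume (⋃ c ∈ s, Metric.ball (c : Vec d) (ε / 2)) := by
          rw [measure_biUnion_finset hdisj fun c _ => measurableSet_ball]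
          simp only [Measure.addHaar_ball_of_pos volume _ hr, Finset.sum_const, nsmul_eq_mul,
            mul_assoc, finrank_euclideanSpace_fin]
      _ ≤ volume (Metric.ball (0 : Vec d) (1 + ε / 2)) := measure_mono hsub
      _ = _ := by rw [Measure.addHaar_ball_of_pos volume _ hR, finrank_euclideanSpace_fin]
  have h1 := (ENNReal.mul_le_mul_iff_left (Metric.measure_ball_pos volume (0 : Vec d) one_pos).ne'
    measure_ball_lt_top.ne).1 hvol
  have h2 := ENNReal.toReal_le_of_le_ofReal (pow_nonneg hR.le _) h1
  rw [ENNReal.toReal_mul, ENNReal.toReal_natCast, ENNReal.toReal_ofReal (by positivity)] at h2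
  have h3 : (1 + 2 / ε) ^ d = (1 + ε / 2) ^ d / (ε / 2) ^ d := by
    rw [← div_pow]
    congr 1
    field_simp
    ring
  rw [h3, le_div_iff₀ (by positivity)]
  exact h2

/-- An `ε`-separated subset of the sphere of largest cardinality is a net, since a point far from
all its members could be added. The volume bound ensures that a largest cardinality exists. -/
theorem exists_sphere_net (d : ℕ) {ε : ℝ} (hε : 0 < ε) :
    ∃ s : Finset (Vec d), (∀ w ∈ s, ‖w‖ = 1) ∧ (∀ v : Vec d, ‖v‖ = 1 → ∃ w ∈ s, ‖v - w‖ ≤ ε) ∧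
      (s.card : ℝ) ≤ (1 + 2 / ε) ^ d := by
  classical
  let good : Finset (Vec d) → Prop := fun s =>
    (∀ w ∈ s, ‖w‖ = 1) ∧ ∀ c ∈ s, ∀ c' ∈ s, c ≠ c' → ε ≤ ‖c - c'‖
  have hcard : ∀ s, good s → (s.card : ℝ) ≤ (1 + 2 / ε) ^ d := fun s hs =>
    card_le_of_separated_of_norm_le_one hε s (fun c hc => (hs.1 c hc).le) hs.2
  obtain ⟨s, hs, hsc⟩ := Nat.findGreatest_spec (P := fun k => ∃ s, good s ∧ s.card = k)
    (n := ⌊(1 + 2 / ε) ^ d⌋₊) (m := 0) (Nat.zero_le _) ⟨∅, ⟨by simp, by simp⟩, rfl⟩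
  refine ⟨s, hs.1, fun v hv => ?_, hcard s hs⟩
  by_contra! hfar
  have hvs : v ∉ s := fun hmem => by
    have := hfar v hmem
    simp only [sub_self, norm_zero] at this
    linarith
  have hgood : good (insert v s) := by
    refine ⟨fun w hw => ?_, fun c hc c' hc' hcc => ?_⟩
    · rcases Finset.mem_insert.1 hw with rfl | hw
      · exact hv
      · exact hs.1 w hw
    · rcases Finset.mem_insert.1 hc with h | h <;> rcases Finset.mem_insert.1 hc' with h' | h'
      · exact absurd (h.trans h'.symm) hcc
      · exact h ▸ (hfar c' h').le
      · rw [h', norm_sub_rev]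
        exact (hfar c h).le
      · exact hs.2 c h c' h' hcc
  have hle := Nat.le_findGreatest (P := fun k => ∃ s, good s ∧ s.card = k)
    (Nat.le_floor (hcard _ hgood)) ⟨_, hgood, rfl⟩
  rw [Finset.card_insert_of_notMem hvs, hsc] at hle
  omega

end SphereNet

/-! ### A lower-tail Chernoff bound for variables in `[0, 1]` -/

section Chernoff

variable {Ω : Type*} [MeasurableSpace Ω] {P : Measure Ω} [IsProbabilityMeasure P]

theorem exp_neg_half_le : Real.exp (-(1 / 2)) ≤ 39 / 64 := by
  have h : Real.exp (-(1 / 2)) ^ 2 = Real.exp (-1) := by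
    rw [← Real.exp_nat_mul]; norm_num
  have h1 := Real.exp_neg_one_lt_d9
  refine le_of_sq_le_sq ?_ (by norm_num)
  rw [h]
  norm_num at h1 ⊢
  linarith

/-- On `[0, 1]` the convex function `exp (-y/2)` lies below its chord, of slope at most `39/64 - 1 =
-25/64`; then `1 + x ≤ exp x`. -/
theorem mgf_neg_half_le {Y : Ω → ℝ} (hY : Measurable Y) (h0 : ∀ᵐ ω ∂P, 0 ≤ Y ω)
    (h1 : ∀ᵐ ω ∂P, Y ω ≤ 1) {l : ℝ} (hl : l ≤ ∫ ω, Y ω ∂P) :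
    mgf Y P (-(1 / 2)) ≤ Real.exp (-(25 / 64 * l)) := by
  have hint : Integrable Y P := by
    refine Integrable.of_bound hY.aestronglyMeasurable 1 ?_
    filter_upwards [h0, h1] with ω h0 h1
    rw [Real.norm_eq_abs, abs_of_nonneg h0]
    exact h1
  have hpt : ∀ y : ℝ, 0 ≤ y → y ≤ 1 → Real.exp (-(1 / 2) * y) ≤ 1 - 25 / 64 * y := by
    intro y hy0 hy1
    have hconv := convexOn_exp.2 (Set.mem_univ (0 : ℝ)) (Set.mem_univ (-(1 / 2) : ℝ))
      (sub_nonneg.2 hy1) hy0 (by ring)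
    simp only [smul_eq_mul, mul_zero, zero_add, Real.exp_zero, mul_one] at hconv
    rw [mul_comm]
    nlinarith [exp_neg_half_le, mul_le_mul_of_nonneg_left exp_neg_half_le hy0]
  have h2 : mgf Y P (-(1 / 2)) ≤ ∫ ω, (1 - 25 / 64 * Y ω) ∂P := by
    refine integral_mono_ae ?_ ((integrable_const _).sub (hint.const_mul _)) ?_
    · refine Integrable.of_bound (by fun_prop) 1 ?_
      filter_upwards [h0] with ω h0
      rw [Real.norm_eq_abs, Real.abs_exp]
      exact Real.exp_le_one_iff.2 (by nlinarith)
    · filter_upwards [h0, h1] with ω h0 h1 using hpt _ h0 h1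
  rw [integral_sub (integrable_const _) (hint.const_mul _), integral_const_mul] at h2
  simp only [integral_const, probReal_univ, smul_eq_mul, mul_one] at h2
  have h3 := Real.add_one_le_exp (-(25 / 64 * l))
  linarith

/-- The parameter is `-1/2`, with exponent `9/32 - 25/64 = -7/64`. The level `9/16 = (3/4)²` is
above `1/2` to leave room for the net perturbation. -/
theorem measureReal_sum_le_le_exp {ι : Type*} [Fintype ι] {Y : ι → Ω → ℝ}
    (hind : iIndepFun Y P) (hY : ∀ i, Measurable (Y i)) (h0 : ∀ i, ∀ᵐ ω ∂P, 0 ≤ Y i ω)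
    (h1 : ∀ i, ∀ᵐ ω ∂P, Y i ω ≤ 1) {l : ℝ} (hl : ∀ i, l ≤ ∫ ω, Y i ω ∂P) :
    P.real {ω | ∑ i, Y i ω ≤ 9 / 16 * l * Fintype.card ι}
      ≤ Real.exp (-(7 / 64 * l * Fintype.card ι)) := by
  have h0' : ∀ᵐ ω ∂P, ∀ i, 0 ≤ Y i ω := ae_all_iff.2 h0
  have hm := measure_le_le_exp_mul_mgf (μ := P) (X := ∑ i, Y i) (t := -(1 / 2))
    (9 / 16 * l * Fintype.card ι) (by norm_num) (by
      refine Integrable.of_bound (by fun_prop) 1 ?_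
      filter_upwards [h0'] with ω h0
      rw [Real.norm_eq_abs, Real.abs_exp]
      refine Real.exp_le_one_iff.2 ?_
      have : 0 ≤ (∑ i, Y i) ω := by
        rw [Finset.sum_apply]; exact Finset.sum_nonneg fun i _ => h0 i
      linarith)
  rw [hind.mgf_sum hY] at hm
  have hprod : ∏ i, mgf (Y i) P (-(1 / 2)) ≤ ∏ _i : ι, Real.exp (-(25 / 64 * l)) :=
    Finset.prod_le_prod (fun i _ => mgf_nonneg) fun i _ =>
      mgf_neg_half_le (hY i) (h0 i) (h1 i) (hl i)
  rw [Finset.prod_const, Finset.card_univ, ← Real.exp_nat_mul] at hprod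
  simp only [Finset.sum_apply] at hm
  refine hm.trans ((mul_le_mul_of_nonneg_left hprod (Real.exp_pos _).le).trans_eq ?_)
  rw [← Real.exp_add]
  congr 1
  ring

end Chernoff

/-! ### Independence of blocks -/

section Independence

/-- Grouping a jointly independent family into blocks yields independent blocks. -/
theorem iIndepFun_curry {Ω : Type*} [MeasurableSpace Ω] {P : Measure Ω} [IsProbabilityMeasure P]
    {ι : Type*} {κ : ι → Type*} {E : Type*} [MeasurableSpace E]
    {c : (i : ι) → κ i → Ω → E} (hc : ∀ i j, Measurable (c i j))
    (hind : iIndepFun (fun (p : (i : ι) × κ i) => c p.1 p.2) P) :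
    iIndepFun (fun i ω (j : κ i) => c i j ω) P ∧ ∀ i, iIndepFun (c i) P := by
  have hblock : ∀ i, iIndepFun (c i) P := fun i =>
    hind.precomp (g := fun j => (⟨i, j⟩ : (i : ι) × κ i)) sigma_mk_injective
  refine ⟨?_, hblock⟩
  have hp : ∀ i j, IsProbabilityMeasure (P.map (c i j)) := fun i j =>
    Measure.isProbabilityMeasure_map (hc i j).aemeasurable
  rw [iIndepFun_iff_map_fun_eq_infinitePi_map (fun i => measurable_pi_iff.2 (hc i))]
  have h1 := (iIndepFun_iff_map_fun_eq_infinitePi_map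
    (fun p : (i : ι) × κ i => hc p.1 p.2)).1 hind
  have h2 := Measure.infinitePi_map_piCurry (X := fun _ _ => E) fun i j => P.map (c i j)
  have hm : Measurable fun ω (p : (i : ι) × κ i) => c p.1 p.2 ω :=
    measurable_pi_iff.2 fun p => hc p.1 p.2
  rw [← h1, Measure.map_map (by fun_prop) hm] at h2
  refine (Eq.trans ?_ h2).trans ?_
  · rfl
  · congr 1
    ext1 i
    exact ((iIndepFun_iff_map_fun_eq_infinitePi_map (hc i)).1 (hblock i)).symm

end Independence

/-! ### Consequences of action regularity -/

namespace ActionRegular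

variable {d : ℕ} {ρ : Measure (Vec d)} {lamA σ : ℝ}

/-- In dimension zero the spectrum is empty and has no least element. -/
theorem dim_pos (hρ : ActionRegular ρ lamA σ) : 0 < d := by
  rcases Nat.eq_zero_or_pos d with rfl | h
  · have h1 := hρ.minEigenvalue.1
    rw [spectrum.of_subsingleton] at h1
    exact h1.elim
  · exact h

theorem integrable_mul (hρ : ActionRegular ρ lamA σ) (i j : Fin d) :
    Integrable (fun a : Vec d => a i * a j) ρ := by
  have := hρ.isProb
  refine Integrable.of_bound (by fun_prop) 1 ?_
  filter_upwards [hρ.norm_le] with a ha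
  rw [norm_mul]
  exact mul_le_one₀ ((PiLp.norm_apply_le a i).trans ha) (norm_nonneg _)
    ((PiLp.norm_apply_le a j).trans ha)

theorem dotProduct_secondMoment (hρ : ActionRegular ρ lamA σ) (w : Vec d) :
    w.ofLp ⬝ᵥ (secondMoment ρ *ᵥ w.ofLp) = ∫ a, ⟪w, a⟫ ^ 2 ∂ρ := by
  have h1 : ∀ a : Vec d, ⟪w, a⟫ ^ 2 = ∑ i, ∑ j, w i * w j * (a i * a j) := fun a => by
    rw [← Dataset.dotProduct_ofLp, sq, dotProduct, Finset.sum_mul_sum]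
    exact Finset.sum_congr rfl fun i _ => Finset.sum_congr rfl fun j _ => by ring
  simp_rw [h1]
  rw [integral_finsetSum _ fun i _ => integrable_finsetSum _ fun j _ =>
    (hρ.integrable_mul i j).const_mul _]
  simp only [dotProduct, Matrix.mulVec, secondMoment, Matrix.of_apply, Finset.mul_sum]
  refine Finset.sum_congr rfl fun i _ => ?_
  rw [integral_finsetSum _ fun j _ => (hρ.integrable_mul i j).const_mul _]
  refine Finset.sum_congr rfl fun j _ => ?_
  rw [integral_const_mul]
  ring

theorem le_integral_inner_sq (hρ : ActionRegular ρ lamA σ) {w : Vec d} (hw : ‖w‖ = 1) :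
    lamA ≤ ∫ a, ⟪w, a⟫ ^ 2 ∂ρ := by
  have hherm : (secondMoment ρ).IsHermitian := by
    refine Matrix.IsHermitian.ext fun i j => ?_
    simp [secondMoment, mul_comm]
  have hherm' : (secondMoment ρ - lamA • (1 : Matrix (Fin d) (Fin d) ℝ)).IsHermitian := by
    refine hherm.sub ?_
    refine Matrix.IsHermitian.ext fun i j => ?_
    simp [Matrix.one_apply, eq_comm]
  have hpsd : (secondMoment ρ - lamA • (1 : Matrix (Fin d) (Fin d) ℝ)).PosSemidef := by
    rw [Matrix.posSemidef_iff_isHermitian_and_spectrum_nonneg]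
    refine ⟨hherm', fun x hx => ?_⟩
    -- Subtracting `lamA • 1` shifts the spectrum by `lamA`, its least element, so the shifted
    -- spectrum is nonnegative.
    rw [← Algebra.algebraMap_eq_smul_one, sub_eq_add_neg, add_comm,
      ← spectrum.add_mem_iff] at hx
    have := hρ.minEigenvalue.2 hx
    simp only [Set.mem_ofPred_eq]
    linarith
  have h := hpsd.dotProduct_mulVec_nonneg w.ofLp
  rw [star_trivial, Matrix.sub_mulVec, dotProduct_sub, hρ.dotProduct_secondMoment,
    Matrix.smul_mulVec, Matrix.one_mulVec, dotProduct_smul, Dataset.dotProduct_ofLp_self, hw] at h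
  simp only [one_pow, smul_eq_mul, mul_one] at h
  linarith

/-- The trace of the second moment matrix is `E‖a‖² ≤ 1`, while each of its `d` diagonal entries is
at least `lamA`. -/
theorem dim_mul_le_one (hρ : ActionRegular ρ lamA σ) : d * lamA ≤ 1 := by
  have := hρ.isProb
  have h1 : ∀ i : Fin d, lamA ≤ ∫ a : Vec d, a i * a i ∂ρ := fun i => by
    have h := hρ.le_integral_inner_sq (w := EuclideanSpace.single i 1) (by simp)
    simpa [EuclideanSpace.inner_single_left, sq] using h
  calc (d : ℝ) * lamA = ∑ _i : Fin d, lamA := by simp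
    _ ≤ ∑ i : Fin d, ∫ a : Vec d, a i * a i ∂ρ := Finset.sum_le_sum fun i _ => h1 i
    _ = ∫ a : Vec d, ∑ i, a i * a i ∂ρ :=
        (integral_finsetSum _ fun i _ => hρ.integrable_mul i i).symm
    _ ≤ ∫ _a : Vec d, (1 : ℝ) ∂ρ := by
        refine integral_mono_ae (integrable_finsetSum _ fun i _ => hρ.integrable_mul i i)
          (integrable_const _) ?_
        filter_upwards [hρ.norm_le] with a ha
        have h2 := Dataset.dotProduct_ofLp_self a
        rw [dotProduct] at h2
        rw [h2]
        exact pow_le_one₀ (norm_nonneg _) ha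
    _ = 1 := by simp

/-- The lower tail at deviation `μ - x`, which is at least `lamA - x` because the mean `μ` is at
least `lamA`. -/
theorem le_measureReal_lt_inner_sq (hρ : ActionRegular ρ lamA σ) {w : Vec d} (hw : ‖w‖ = 1)
    {x : ℝ} (hx : x ≤ lamA) :
    1 - Real.exp (-(lamA - x) ^ 2 / (2 * σ ^ 2)) ≤ ρ.real {a | x < ⟪w, a⟫ ^ 2} := by
  have := hρ.isProb
  have hm := hρ.le_integral_inner_sq hw
  set μ := ∫ a, ⟪w, a⟫ ^ 2 ∂ρ with hμ
  have ht := (hρ.tails w hw (μ - x) (by linarith)).2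
  have hset : {a : Vec d | x < ⟪w, a⟫ ^ 2}ᶜ = {a | ⟪w, a⟫ ^ 2 - μ ≤ -(μ - x)} := by
    ext a
    simp
  have hmeas : MeasurableSet {a : Vec d | x < ⟪w, a⟫ ^ 2} :=
    measurableSet_lt measurable_const ((measurable_const.inner measurable_id).pow_const 2)
  have h1 := probReal_compl_eq_one_sub (μ := ρ) hmeas
  rw [hset] at h1
  have h2 : Real.exp (-(μ - x) ^ 2 / (2 * σ ^ 2)) ≤ Real.exp (-(lamA - x) ^ 2 / (2 * σ ^ 2)) := by
    refine Real.exp_le_exp.2 (div_le_div_of_nonneg_right ?_ (by positivity))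
    exact neg_le_neg (pow_le_pow_left₀ (by linarith) (by linarith) 2)
  linarith

end ActionRegular

/-! ### The smoothed regularity parameter -/

section SmoothedReg

variable {lamA σ : ℝ}

theorem one_sub_exp_mem_Icc (x : ℝ) :
    1 - Real.exp (-(lamA - x) ^ 2 / (2 * σ ^ 2)) ∈ Set.Icc (0 : ℝ) 1 := by
  refine ⟨sub_nonneg.2 (Real.exp_le_one_iff.2 ?_), sub_le_self _ (Real.exp_pos _).le⟩
  exact div_nonpos_of_nonpos_of_nonneg (by nlinarith [sq_nonneg (lamA - x)]) (by positivity)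

theorem continuous_smoothedReg_integrand (S : ℕ) :
    Continuous fun x : ℝ => (1 - Real.exp (-(lamA - x) ^ 2 / (2 * σ ^ 2))) ^ S := by
  fun_prop

theorem smoothedReg_pos (hl : 0 < lamA) (hσ : 0 < σ) (S : ℕ) : 0 < smoothedReg lamA σ S := by
  refine intervalIntegral.intervalIntegral_pos_of_pos_on
    ((continuous_smoothedReg_integrand S).intervalIntegrable _ _) (fun x hx => ?_) hl
  refine pow_pos (sub_pos.2 (Real.exp_lt_one_iff.2 ?_)) _
  have : 0 < lamA - x := sub_pos.2 hx.2
  rw [neg_div]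
  exact neg_lt_zero.2 (by positivity)

theorem smoothedReg_le (hl : 0 < lamA) (S : ℕ) : smoothedReg lamA σ S ≤ lamA := by
  have h := intervalIntegral.integral_mono_on (μ := volume) (f := fun x : ℝ =>
      (1 - Real.exp (-(lamA - x) ^ 2 / (2 * σ ^ 2))) ^ S) (g := fun _ => 1) hl.le
    ((continuous_smoothedReg_integrand S).intervalIntegrable _ _)
    intervalIntegrable_const
    (fun x _ => pow_le_one₀ (one_sub_exp_mem_Icc x).1 (one_sub_exp_mem_Icc x).2)
  simpa [smoothedReg] using h

end SmoothedReg

/-! ### The worst candidate in a direction, and the net step -/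

section MinSq

variable {d : ℕ} {κ : Type*} [Fintype κ] [Nonempty κ]

/-- The smallest squared component along `w` among finitely many vectors. -/
noncomputable def minSq (w : Vec d) (c : κ → Vec d) : ℝ :=
  Finset.univ.inf' Finset.univ_nonempty fun j => ⟪w, c j⟫ ^ 2

theorem measurable_minSq (w : Vec d) : Measurable (minSq (κ := κ) w) := by
  have h : minSq (κ := κ) w = Finset.univ.inf' Finset.univ_nonempty
      (fun j (c : κ → Vec d) => ⟪w, c j⟫ ^ 2) := by
    ext c
    rw [minSq, Finset.inf'_apply]
  rw [h]
  exact Finset.inf'_induction _ _ (fun _ hf _ hg => hf.inf hg) fun j _ =>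
    (measurable_const.inner (measurable_pi_apply j)).pow_const 2

theorem minSq_nonneg (w : Vec d) (c : κ → Vec d) : 0 ≤ minSq w c :=
  (Finset.le_inf'_iff _ _).2 fun _ _ => sq_nonneg _

theorem minSq_le (w : Vec d) (c : κ → Vec d) (j : κ) : minSq w c ≤ ⟪w, c j⟫ ^ 2 :=
  Finset.inf'_le _ (Finset.mem_univ j)

theorem minSq_le_one {w : Vec d} (hw : ‖w‖ = 1) {c : κ → Vec d} (hc : ∀ j, ‖c j‖ ≤ 1) :
    minSq w c ≤ 1 := by
  obtain ⟨j⟩ := ‹Nonempty κ›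
  refine (minSq_le w c j).trans ?_
  rw [sq_le_one_iff_abs_le_one]
  refine (abs_real_inner_le_norm _ _).trans ?_
  rw [hw, one_mul]
  exact hc j

/-- The expected minimal squared component of at most `S` independent candidates is at least the
smoothed regularity parameter. -/
theorem smoothedReg_le_integral_minSq {Ω : Type*} [MeasurableSpace Ω] {P : Measure Ω}
    [IsProbabilityMeasure P] {ρ : Measure (Vec d)} {lamA σ : ℝ} (hρ : ActionRegular ρ lamA σ)
    {S : ℕ} (hS : Fintype.card κ ≤ S) {c : κ → Ω → Vec d} (hc : ∀ j, Measurable (c j))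
    (hlaw : ∀ j, P.map (c j) = ρ) (hind : iIndepFun c P) {w : Vec d} (hw : ‖w‖ = 1) :
    smoothedReg lamA σ S ≤ ∫ ω, minSq w (fun j => c j ω) ∂P := by
  have hYm : Measurable fun ω => minSq w fun j => c j ω :=
    (measurable_minSq w).comp (measurable_pi_iff.2 hc)
  have hnorm : ∀ᵐ ω ∂P, ∀ j, ‖c j ω‖ ≤ 1 := by
    refine ae_all_iff.2 fun j => ?_
    have h := hρ.norm_le
    rw [← hlaw j] at h
    exact ae_of_ae_map (hc j).aemeasurable h
  have hint : Integrable (fun ω => minSq w fun j => c j ω) P := by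
    refine Integrable.of_bound hYm.aestronglyMeasurable 1 ?_
    filter_upwards [hnorm] with ω hω
    rw [Real.norm_eq_abs, abs_of_nonneg (minSq_nonneg _ _)]
    exact minSq_le_one hw hω
  have hmeasx : ∀ x : ℝ, MeasurableSet {a : Vec d | x < ⟪w, a⟫ ^ 2} := fun x =>
    measurableSet_lt measurable_const ((measurable_const.inner measurable_id).pow_const 2)
  -- The minimum exceeds `x` exactly when all candidates do, and by independence this probability is
  -- a product. Having fewer than `S` factors only increases it.
  have hprob : ∀ x ∈ Set.Ioc 0 lamA,
      ENNReal.ofReal ((1 - Real.exp (-(lamA - x) ^ 2 / (2 * σ ^ 2))) ^ S)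
        ≤ P {ω | x < minSq w fun j => c j ω} := by
    intro x hx
    have hset : {ω | x < minSq w fun j => c j ω} = ⋂ j, c j ⁻¹' {a | x < ⟪w, a⟫ ^ 2} := by
      ext ω
      simp [minSq, Finset.lt_inf'_iff]
    have hprod : P {ω | x < minSq w fun j => c j ω}
        = ∏ _j : κ, ρ {a | x < ⟪w, a⟫ ^ 2} := by
      rw [hset, hind.meas_iInter fun j => ⟨_, hmeasx x, rfl⟩]
      exact Finset.prod_congr rfl fun j _ => by
        rw [← hlaw j, Measure.map_apply (hc j) (hmeasx x)]
    have := hρ.isProb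
    rw [hprod, Finset.prod_const, Finset.card_univ, ← ofReal_measureReal,
      ← ENNReal.ofReal_pow measureReal_nonneg]
    refine ENNReal.ofReal_le_ofReal ?_
    have hmem := one_sub_exp_mem_Icc (lamA := lamA) (σ := σ) x
    calc _ ≤ (1 - Real.exp (-(lamA - x) ^ 2 / (2 * σ ^ 2))) ^ Fintype.card κ :=
          pow_le_pow_of_le_one hmem.1 hmem.2 hS
      _ ≤ _ := pow_le_pow_left₀ hmem.1 (hρ.le_measureReal_lt_inner_sq hw hx.2) _
  have hnn : 0 ≤ ∫ ω, minSq w (fun j => c j ω) ∂P :=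
    integral_nonneg fun ω => minSq_nonneg _ _
  -- Layer-cake formula for the mean; only levels in `(0, lamA]` are kept.
  rw [← ENNReal.ofReal_le_ofReal_iff hnn, ofReal_integral_eq_lintegral_ofReal hint
    (ae_of_all _ fun ω => minSq_nonneg _ _),
    lintegral_eq_lintegral_meas_lt P (ae_of_all _ fun ω => minSq_nonneg _ _) hYm.aemeasurable,
    smoothedReg, intervalIntegral.integral_of_le hρ.lamA_pos.le,
    ofReal_integral_eq_lintegral_ofReal
      ((continuous_smoothedReg_integrand S).integrableOn_Ioc)
      (ae_of_all _ fun x => pow_nonneg (one_sub_exp_mem_Icc x).1 S)]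
  calc _ ≤ ∫⁻ x in Set.Ioc 0 lamA, P {ω | x < minSq w fun j => c j ω} :=
        setLIntegral_mono' measurableSet_Ioc hprob
    _ ≤ _ := lintegral_mono_set Set.Ioc_subset_Ioi_self

end MinSq

/-- A lower bound for `∑ ⟨w, aᵢ⟩²` at a point `w` near `v` carries over to `v`. -/
theorem half_le_sum_inner_sq_of_near {d n : ℕ} {a : Fin n → Vec d} (ha : ∀ i, ‖a i‖ ≤ 1) {l : ℝ}
    (hl : 0 ≤ l) {v w : Vec d} (hvw : ‖v - w‖ ≤ √l / 24)
    (hw : 9 / 16 * l * n ≤ ∑ i, ⟪w, a i⟫ ^ 2) : l * n / 2 ≤ ∑ i, ⟪v, a i⟫ ^ 2 := by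
  -- The triangle inequality in `ℝⁿ` compares the two vectors of components: `3/4 - 1/24 = 17/24`,
  -- and `(17/24)² = 289/576` just exceeds `1/2`.
  let x : EuclideanSpace ℝ (Fin n) := WithLp.toLp 2 fun i => ⟪v, a i⟫
  let y : EuclideanSpace ℝ (Fin n) := WithLp.toLp 2 fun i => ⟪w, a i⟫
  have hx : ‖x‖ ^ 2 = ∑ i, ⟪v, a i⟫ ^ 2 := EuclideanSpace.real_norm_sq_eq x
  have hy : ‖y‖ ^ 2 = ∑ i, ⟪w, a i⟫ ^ 2 := EuclideanSpace.real_norm_sq_eq y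
  set r := √(l * n) with hr
  have hr0 : 0 ≤ r := Real.sqrt_nonneg _
  have hr2 : r ^ 2 = l * n := Real.sq_sqrt (by positivity)
  have hxy : ‖x - y‖ ≤ r / 24 := by
    refine le_of_sq_le_sq ?_ (by positivity)
    have h1 : ‖x - y‖ ^ 2 = ∑ i, ⟪v - w, a i⟫ ^ 2 := by
      rw [EuclideanSpace.real_norm_sq_eq]
      refine Finset.sum_congr rfl fun i _ => ?_
      rw [inner_sub_left]
      rfl
    have h2 : ∀ i, ⟪v - w, a i⟫ ^ 2 ≤ l / 576 := fun i => by
      have h3 : |⟪v - w, a i⟫| ≤ √l / 24 := (abs_real_inner_le_norm _ _).trans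
        ((mul_le_of_le_one_right (norm_nonneg _) (ha i)).trans hvw)
      rw [← sq_abs]
      refine (pow_le_pow_left₀ (abs_nonneg _) h3 2).trans_eq ?_
      rw [div_pow, Real.sq_sqrt hl]
      norm_num
    rw [h1, div_pow, hr2]
    refine (Finset.sum_le_sum fun i _ => h2 i).trans_eq ?_
    simp only [Finset.sum_const, Finset.card_univ, Fintype.card_fin, nsmul_eq_mul]
    ring
  have hy1 : 3 / 4 * r ≤ ‖y‖ := by
    refine le_of_sq_le_sq ?_ (norm_nonneg _)
    rw [hy, mul_pow, hr2]
    linarith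
  have htri : ‖y‖ ≤ ‖x‖ + ‖x - y‖ := by
    rw [norm_sub_rev]
    exact norm_le_norm_add_norm_sub' y x
  have hx1 : 17 / 24 * r ≤ ‖x‖ := by linarith
  have hx2 := pow_le_pow_left₀ (by positivity) hx1 2
  rw [hx, mul_pow, hr2] at hx2
  have : 0 ≤ l * n := by positivity
  linarith

/-- Since `d ≤ 1/l`, the sample size makes the exponent at least `d · (7/4) log B`. The product is
thus bounded by the `d`-th power of `49/s · q`, and it suffices that this base is at most `δ/U`. -/
theorem net_card_mul_exp_le {d U N : ℕ} {l δ : ℝ} (hd : 0 < d) (hU : 0 < U) (hl : 0 < l)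
    (hdl : d * l ≤ 1) (hδ₀ : 0 < δ) (hδ₁ : δ < 1 / 2)
    (hN : 16 / l ^ 2 * Real.log (8 * d * U / (l ^ 2 * δ)) ≤ N) :
    (1 + 2 / (√l / 24)) ^ d * Real.exp (-(7 / 64 * l * N)) ≤ δ / U := by
  have hd1 : (1 : ℝ) ≤ d := by exact_mod_cast hd
  have hU1 : (1 : ℝ) ≤ U := by exact_mod_cast hU
  have hl1 : l ≤ 1 := by nlinarith
  set s := √l with hs
  have hs0 : 0 < s := Real.sqrt_pos.2 hl
  have hs2 : s ^ 2 = l := Real.sq_sqrt hl.le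
  have hs1 : s ≤ 1 := Real.sqrt_le_one.2 hl1
  set B := 8 * d * U / (l ^ 2 * δ) with hB
  have hB0 : 0 < B := by positivity
  have hB1 : 1 ≤ B := by
    rw [hB, one_le_div (by positivity)]
    have h1 : l ^ 2 ≤ 1 := pow_le_one₀ hl.le hl1
    have h2 : 1 ≤ (d : ℝ) * U := one_le_mul_of_one_le_of_one_le hd1 hU1
    nlinarith
  have hlog : 0 ≤ Real.log B := Real.log_nonneg hB1
  set q := Real.exp (-(7 / 4 * Real.log B)) with hq
  have hexp : Real.exp (-(7 / 64 * l * N)) ≤ q ^ d := by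
    rw [hq, ← Real.exp_nat_mul]
    refine Real.exp_le_exp.2 ?_
    have h1 : 7 / 64 * l * (16 / l ^ 2 * Real.log B) ≤ 7 / 64 * l * N := by gcongr
    have h2 : 7 / 64 * l * (16 / l ^ 2 * Real.log B) = 7 / 4 * Real.log B * (1 / l) := by
      field_simp
      ring
    have h3 : (d : ℝ) ≤ 1 / l := by rwa [le_div_iff₀ hl]
    have h4 : 7 / 4 * Real.log B * d ≤ 7 / 4 * Real.log B * (1 / l) := by gcongr
    linarith
  have hnet : 1 + 2 / (s / 24) ≤ 49 / s := by
    rw [le_div_iff₀ hs0]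
    have : (1 + 2 / (s / 24)) * s = s + 48 := by
      field_simp
      ring
    linarith
  set x := δ / U with hx
  have hx0 : 0 < x := by positivity
  have hx1 : x ≤ 1 / 2 := by
    rw [hx, div_le_iff₀ (by positivity)]
    nlinarith
  -- Fourth powers remove the root and the fractional exponent: `s⁴ = l²` and `q⁴ = B⁻⁷`. The
  -- remaining constant is `49⁴/8⁷ < 8`.
  have hstep : 49 / s * q ≤ x := by
    refine le_of_pow_le_pow_left₀ (n := 4) (by norm_num) hx0.le ?_
    have hq4 : q ^ 4 = (B ^ 7)⁻¹ := by
      rw [hq, ← Real.exp_nat_mul, ← Real.exp_log (pow_pos hB0 7), ← Real.exp_neg, Real.log_pow]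
      congr 1
      push_cast
      ring
    have hBinv : B⁻¹ ≤ l ^ 2 * x / 8 := by
      have h1 : B⁻¹ = l ^ 2 * x / 8 * (1 / d) := by
        rw [hB, hx]
        field_simp
      rw [h1]
      refine mul_le_of_le_one_right (by positivity) ?_
      rw [div_le_one (by positivity)]
      exact hd1
    have hs4 : s ^ 4 = l ^ 2 := by rw [← hs2]; ring
    rw [mul_pow, div_pow, hs4, hq4, ← inv_pow]
    calc 49 ^ 4 / l ^ 2 * B⁻¹ ^ 7 ≤ 49 ^ 4 / l ^ 2 * (l ^ 2 * x / 8) ^ 7 := by gcongr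
      _ = 49 ^ 4 / 8 ^ 7 * (l ^ 12 * (x ^ 3 * x ^ 4)) := by
          field_simp
      _ ≤ 49 ^ 4 / 8 ^ 7 * (1 * ((1 / 2) ^ 3 * x ^ 4)) := by
          gcongr
          exact pow_le_one₀ hl.le hl1
      _ ≤ x ^ 4 := by
          have : 0 ≤ x ^ 4 := by positivity
          nlinarith
  calc _ ≤ (49 / s) ^ d * q ^ d := by gcongr
    _ = (49 / s * q) ^ d := (mul_pow _ _ _).symm
    _ ≤ x ^ d := by gcongr
    _ ≤ x ^ 1 := pow_le_pow_of_le_one hx0.le (by linarith) hd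
    _ = x := pow_one x

/-! ### Excitation of all directions under arbitrary selection -/

namespace OfflineData

variable {Ω : Type*} [mΩ : MeasurableSpace Ω] {P : Measure Ω} [IsProbabilityMeasure P]
  {U d : ℕ} {θ : Fin U → Vec d} {ρ : Measure (Vec d)} {S : ℕ} (X : OfflineData P θ ρ S)

theorem nonempty_cand (u : Fin U) (i : Fin (X.N u)) : Nonempty (Fin (X.numCand u i)) := by
  obtain ⟨ω, j, -⟩ := (X.act_mem u i).exists
  exact ⟨j⟩

/-- The selected actions may depend on one another, but the minima over distinct candidate sets of
one user are independent, so the Chernoff bound applies to them. -/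
theorem measureReal_sum_minSq_le {lamA σ : ℝ} (hρ : ActionRegular ρ lamA σ) (u : Fin U)
    {w : Vec d} (hw : ‖w‖ = 1) :
    have := X.nonempty_cand u
    P.real {ω | ∑ i, minSq w (fun j => X.cand u i j ω) ≤ 9 / 16 * smoothedReg lamA σ S * X.N u}
      ≤ Real.exp (-(7 / 64 * smoothedReg lamA σ S * X.N u)) := by
  have := X.nonempty_cand u
  obtain ⟨hblocks, hwithin⟩ := iIndepFun_curry (X.cand_measurable u) (X.cand_indep u)
  have hnorm : ∀ i, ∀ᵐ ω ∂P, ∀ j, ‖X.cand u i j ω‖ ≤ 1 := fun i => by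
    refine ae_all_iff.2 fun j => ?_
    have h := hρ.norm_le
    rw [← X.cand_law u i j] at h
    exact ae_of_ae_map (X.cand_measurable u i j).aemeasurable h
  have h := measureReal_sum_le_le_exp (P := P)
    (Y := fun i ω => minSq w fun j => X.cand u i j ω)
    (hblocks.comp (fun i => minSq (κ := Fin (X.numCand u i)) w) fun i => measurable_minSq w)
    (fun i => (measurable_minSq w).comp (measurable_pi_iff.2 (X.cand_measurable u i)))
    (fun i => ae_of_all _ fun ω => minSq_nonneg _ _)
    (fun i => (hnorm i).mono fun ω hω => minSq_le_one hw hω)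
    (l := smoothedReg lamA σ S)
    (fun i => smoothedReg_le_integral_minSq hρ (by simpa using X.numCand_le u i)
      (X.cand_measurable u i) (X.cand_law u i) (hwithin i) hw)
  simpa using h

/-- With high probability the unregularized Gram matrix of user `u` has smallest eigenvalue at
least `λ̃ N_u / 2`, whatever the selection rule. -/
theorem measure_not_half_le_sum_inner_sq_le {lamA σ : ℝ} (hρ : ActionRegular ρ lamA σ) {δ : ℝ}
    (hδ₀ : 0 < δ) (hδ₁ : δ < 1 / 2) (u : Fin U)
    (hN : 16 / smoothedReg lamA σ S ^ 2
      * Real.log (8 * d * U / (smoothedReg lamA σ S ^ 2 * δ)) ≤ X.N u) :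
    P {ω | ¬ ∀ v : Vec d, smoothedReg lamA σ S * X.N u / 2 * ‖v‖ ^ 2
      ≤ ∑ i, ⟪v, X.act u i ω⟫ ^ 2} ≤ ENNReal.ofReal (δ / U) := by
  have hne := X.nonempty_cand u
  set l := smoothedReg lamA σ S with hl
  have hl0 : 0 < l := smoothedReg_pos hρ.lamA_pos hρ.sigma_pos S
  have hdl : d * l ≤ 1 := (mul_le_mul_of_nonneg_left (smoothedReg_le hρ.lamA_pos S)
    (Nat.cast_nonneg d)).trans hρ.dim_mul_le_one
  have hU : 0 < U := u.pos
  obtain ⟨s, hs1, hsnet, hscard⟩ := exists_sphere_net d (ε := √l / 24) (by positivity)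
  have hact : ∀ᵐ ω ∂P, ∀ i, ∃ j, X.act u i ω = X.cand u i j ω := ae_all_iff.2 (X.act_mem u)
  have hbad : ∀ᵐ ω ∂P, (¬ ∀ v : Vec d, l * X.N u / 2 * ‖v‖ ^ 2 ≤ ∑ i, ⟪v, X.act u i ω⟫ ^ 2) →
      ω ∈ ⋃ w ∈ s, {ω | ∑ i, minSq w (fun j => X.cand u i j ω) ≤ 9 / 16 * l * X.N u} := by
    filter_upwards [hact, X.ae_norm_act_le hρ.norm_le] with ω hω hnorm hcon
    by_contra hgood
    simp only [Set.mem_iUnion, not_exists, Set.mem_ofPred_eq, not_le] at hgood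
    refine hcon fun v => ?_
    have hunit : ∀ v : Vec d, ‖v‖ = 1 → l * X.N u / 2 ≤ ∑ i, ⟪v, X.act u i ω⟫ ^ 2 := by
      intro v hv
      obtain ⟨w, hws, hvw⟩ := hsnet v hv
      refine half_le_sum_inner_sq_of_near (hnorm u) hl0.le hvw ((hgood w hws).le.trans ?_)
      refine Finset.sum_le_sum fun i _ => ?_
      obtain ⟨j, hj⟩ := hω i
      rw [hj]
      exact minSq_le w _ j
    rcases eq_or_ne v 0 with rfl | hv
    · simp
    · have hv0 : ‖v‖ ≠ 0 := norm_ne_zero_iff.2 hv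
      have h := hunit (‖v‖⁻¹ • v) (by rw [norm_smul, norm_inv, norm_norm, inv_mul_cancel₀ hv0])
      simp only [real_inner_smul_left, mul_pow, ← Finset.mul_sum] at h
      rwa [inv_pow, ← div_eq_inv_mul, le_div_iff₀ (by positivity)] at h
  calc _ ≤ P (⋃ w ∈ s, {ω | ∑ i, minSq w (fun j => X.cand u i j ω) ≤ 9 / 16 * l * X.N u}) :=
        measure_mono_ae hbad
    _ ≤ ∑ w ∈ s, P {ω | ∑ i, minSq w (fun j => X.cand u i j ω) ≤ 9 / 16 * l * X.N u} :=
        measure_biUnion_finset_le _ _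
    _ ≤ ∑ w ∈ s, ENNReal.ofReal (Real.exp (-(7 / 64 * l * X.N u))) := by
        refine Finset.sum_le_sum fun w hw => ?_
        rw [← ofReal_measureReal]
        exact ENNReal.ofReal_le_ofReal (X.measureReal_sum_minSq_le hρ u (hs1 w hw))
    _ = ENNReal.ofReal (s.card * Real.exp (-(7 / 64 * l * X.N u))) := by
        rw [Finset.sum_const, nsmul_eq_mul, ENNReal.ofReal_mul (Nat.cast_nonneg _),
          ENNReal.ofReal_natCast]
    _ ≤ _ := by
        refine ENNReal.ofReal_le_ofReal (le_trans ?_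
          (net_card_mul_exp_le hρ.dim_pos hU hl0 hdl hδ₀ hδ₁ hN))
        gcongr

end OfflineData

/-! ### Numerical estimates for the confidence radius -/

/-- Bernoulli's inequality `1 + p t ≤ (1 + t)^p` with `p = x/t ≥ 1`. -/
theorem log_one_add_le_mul_log {x t : ℝ} (ht : 0 < t) (hx : t ≤ x) :
    Real.log (1 + x) ≤ x / t * Real.log (1 + t) := by
  have h := one_add_mul_self_le_rpow_one_add (s := t) (by linarith) (p := x / t)
    ((one_le_div ht).2 hx)
  rw [div_mul_cancel₀ _ ht.ne'] at h
  rw [← Real.log_rpow (by linarith)]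
  exact Real.log_le_log (by linarith) h

theorem confRadius_le_two_mul {U d : ℕ} {lam δ : ℝ} {n : ℕ}
    (h : lam ≤ d * Real.log (1 + n / (lam * d)) + 2 * Real.log (2 * U / δ)) :
    confRadius U d lam δ n
      ≤ 2 * √(d * Real.log (1 + n / (lam * d)) + 2 * Real.log (2 * U / δ)) := by
  have h1 := Real.sqrt_le_sqrt h
  unfold confRadius
  linarith

theorem confRadius_nonneg (U d : ℕ) (lam δ : ℝ) (n : ℕ) : 0 ≤ confRadius U d lam δ n := by
  unfold confRadius; positivity

theorem one_lt_two_mul_div {U : ℕ} (hU : 0 < U) {δ : ℝ} (hδ₀ : 0 < δ) (hδ₁ : δ < 1 / 2) :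
    1 < 2 * U / δ := by
  have : (1 : ℝ) ≤ U := by exact_mod_cast hU
  rw [one_lt_div hδ₀]
  linarith

/-- After absorbing `√λ`, the claim follows from `64 (d L + 2 K) < γ² λ̃ n / 2`. Multiplied by `T`,
the right side is `256 d K n`, and the left is at most `192 d K n` once `T L ≤ n K`. -/
theorem confRadius_div_sqrt_lt {U d n : ℕ} {lam lt γ δ : ℝ} (hU : 0 < U) (hd : 0 < d)
    (hlam : 0 < lam) (hlt : 0 < lt) (hγ : 0 < γ) (hδ₀ : 0 < δ) (hδ₁ : δ < 1 / 2)
    (hn : gapThreshold U d lt γ δ ≤ n)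
    (hlam_le : lam ≤ d * Real.log (1 + n / (lam * d)) + 2 * Real.log (2 * U / δ))
    (hδ_le : δ ≤ 2 * U / (1 + gapThreshold U d lt γ δ / (lam * d))) :
    confRadius U d lam δ n / √(lt * n / 2) < γ / 4 := by
  have hd1 : (1 : ℝ) ≤ d := by exact_mod_cast hd
  have hd0 : (0 : ℝ) < d := by linarith
  set K := Real.log (2 * U / δ) with hK
  have hK0 : 0 < K := Real.log_pos (one_lt_two_mul_div hU hδ₀ hδ₁)
  set T := gapThreshold U d lt γ δ with hT
  have hTdef : T = 512 * d / (γ ^ 2 * lt) * K := rfl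
  have hT0 : 0 < T := by rw [hTdef]; positivity
  have hn0 : (0 : ℝ) < n := hT0.trans_le hn
  set L := Real.log (1 + n / (lam * d)) with hL
  have hKT : T * (γ ^ 2 * lt) = 512 * d * K := by
    rw [hTdef]
    field_simp
  have hlogT : Real.log (1 + T / (lam * d)) ≤ K := by
    refine Real.log_le_log (by positivity) ?_
    rw [le_div_iff₀ hδ₀, mul_comm]
    exact (le_div_iff₀ (by positivity)).1 hδ_le
  -- The condition on `δ` bounds the logarithm at `T` by `K`; since `log (1 + x) / x` decreases, the
  -- estimate extends to `n ≥ T`.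
  have hLle : T * L ≤ n * K := by
    have h1 := log_one_add_le_mul_log (x := n / (lam * d)) (t := T / (lam * d)) (by positivity)
      (by gcongr)
    have h2 : n / (lam * d) / (T / (lam * d)) = n / T := by
      field_simp
    rw [h2] at h1
    have h3 : L ≤ n / T * K := h1.trans (by gcongr)
    calc T * L ≤ T * (n / T * K) := by gcongr
      _ = n * K := by field_simp
  have hmain : 64 * (d * L + 2 * K) < γ ^ 2 * (lt * n / 2) := by
    refine lt_of_mul_lt_mul_left ?_ hT0.le
    have h1 : T * (γ ^ 2 * (lt * n / 2)) = 256 * d * K * n := by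
      linear_combination (n : ℝ) / 2 * hKT
    have h2 : T * (64 * (d * L + 2 * K)) ≤ 64 * d * (n * K) + 128 * (n * K) := by
      have h3 : 64 * d * (T * L) ≤ 64 * d * (n * K) := by gcongr
      have h4 : T * K ≤ n * K := by gcongr
      linarith
    have h5 : n * K ≤ d * (n * K) := le_mul_of_one_le_left (by positivity) hd1
    have h6 : 0 < d * (n * K) := by positivity
    rw [h1]
    linarith
  rw [div_lt_iff₀ (Real.sqrt_pos.2 (by positivity))]
  have h1 := confRadius_le_two_mul hlam_le
  have h2 : 8 * √(d * L + 2 * K) < γ * √(lt * n / 2) := by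
    have h3 := Real.sqrt_lt_sqrt (by linarith) hmain
    rwa [Real.sqrt_mul (by norm_num), Real.sqrt_mul (by positivity), Real.sqrt_sq hγ.le,
      show (64 : ℝ) = 8 ^ 2 by norm_num, Real.sqrt_sq (by norm_num)] at h3
  linarith

theorem two_mul_confRadius_div_le {U d n : ℕ} {lam lt δ : ℝ} (hU : 0 < U) (hd : 0 < d)
    (hlam : 0 < lam) (hlt : 0 < lt) (hδ₀ : 0 < δ) (hδ₁ : δ < 1 / 2) (hn : 0 < n)
    (hlam_le : lam ≤ d * Real.log (1 + n / (lam * d)) + 2 * Real.log (2 * U / δ)) :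
    2 * confRadius U d lam δ n / √(lam + lt * n / 2)
      ≤ 8 * √(d / (lt * n)) * √(Real.log (1 + n / (lam * d)) + Real.log (2 * U / δ)) := by
  have hd1 : (1 : ℝ) ≤ d := by exact_mod_cast hd
  have hn0 : (0 : ℝ) < n := by exact_mod_cast hn
  have hK0 := Real.log_pos (one_lt_two_mul_div hU hδ₀ hδ₁)
  have h1 := confRadius_le_two_mul hlam_le
  set K := Real.log (2 * U / δ)
  set L := Real.log (1 + n / (lam * d)) with hL
  have hL0 : 0 ≤ L := Real.log_nonneg (le_add_of_nonneg_right (by positivity))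
  calc 2 * confRadius U d lam δ n / √(lam + lt * n / 2)
      ≤ 2 * (2 * √(d * L + 2 * K)) / √(lt * n / 2) := by
        gcongr
        linarith
    _ = √(32 * (d * L + 2 * K) / (lt * n)) := by
        rw [← mul_assoc, show (2 : ℝ) * 2 = √16 by
          rw [show (16 : ℝ) = (2 * 2) ^ 2 by norm_num, Real.sqrt_sq (by norm_num)],
          ← Real.sqrt_mul (by norm_num), ← Real.sqrt_div (by positivity)]
        congr 1
        field_simp
        norm_num
    -- Here `d ≥ 1` gives `d L + 2 K ≤ 2 d (L + K)`.
    _ ≤ √(64 * (d / (lt * n)) * (L + K)) := by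
        refine Real.sqrt_le_sqrt ?_
        have h2 : 64 * (d / (lt * n)) * (L + K) = 64 * d * (L + K) / (lt * n) := by ring
        rw [h2]
        refine div_le_div_of_nonneg_right ?_ (by positivity)
        nlinarith [mul_le_mul_of_nonneg_right hd1 hK0.le, mul_nonneg (Nat.cast_nonneg d) hL0]
    _ = _ := by
        rw [Real.sqrt_mul (by positivity), Real.sqrt_mul (by norm_num),
          show (64 : ℝ) = 8 ^ 2 by norm_num, Real.sqrt_sq (by norm_num)]

/-! ### Clustering and pessimism on the confidence event -/

theorem mem_trueCluster {U J : ℕ} {cl : Fin U → Fin J} {u v : Fin U} :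
    v ∈ trueCluster cl u ↔ cl v = cl u := by simp [trueCluster]

theorem sampleCount_singleton {U : ℕ} (N : Fin U → ℕ) (u : Fin U) :
    sampleCount N {u} = N u := by simp [sampleCount]

theorem le_sampleCount_trueCluster {U J : ℕ} (N : Fin U → ℕ) (cl : Fin U → Fin J) (u : Fin U) :
    N u ≤ sampleCount N (trueCluster cl u) :=
  Finset.single_le_sum (f := N) (fun _ _ => Nat.zero_le _) (mem_trueCluster.2 rfl)

namespace Dataset

variable {U d J : ℕ} {D : Dataset U d} {lam lt δ : ℝ}

/-- The confidence ellipsoid of the pooled ridge regression on `V` contains `θ`. -/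
def NoiseBounded (D : Dataset U d) (lam δ : ℝ) (θ : Vec d) (V : Finset (Fin U)) : Prop :=
  D.noise θ V ⬝ᵥ ((D.gram lam V)⁻¹ *ᵥ D.noise θ V)
    ≤ d * Real.log (1 + sampleCount D.N V / (lam * d)) + 2 * Real.log (2 * U / δ)

/-- The actions of every user excite all directions. -/
def Exciting (D : Dataset U d) (lt : ℝ) : Prop :=
  ∀ u, ∀ v : Vec d, lt * D.N u / 2 * ‖v‖ ^ 2 ≤ ∑ i, ⟪v, D.act u i⟫ ^ 2

theorem Exciting.le_gram (hD : D.Exciting lt) (lam : ℝ) (V : Finset (Fin U)) (x : Vec d) :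
    (lam + lt * sampleCount D.N V / 2) * ‖x‖ ^ 2 ≤ x.ofLp ⬝ᵥ (D.gram lam V *ᵥ x.ofLp) := by
  rw [dotProduct_gram_mulVec, add_mul, sampleCount, Nat.cast_sum]
  gcongr
  rw [Finset.mul_sum, Finset.sum_div, Finset.sum_mul]
  exact Finset.sum_le_sum fun u _ => hD u x

theorem norm_ridge_singleton_sub_le (hD : D.Exciting lt) (hlam : 0 < lam) (hlt : 0 < lt)
    {θ : Vec d} (hθ : ‖θ‖ ≤ 1) {u : Fin U} (hN : 0 < D.N u) (hn : D.NoiseBounded lam δ θ {u}) :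
    ‖D.ridge lam {u} - θ‖ ≤ D.CI lam lt δ u := by
  have hN' : (0 : ℝ) < D.N u := by exact_mod_cast hN
  have h := norm_ridge_sub_le hlam (by positivity) hθ hn (hD.le_gram lam {u})
  rw [sampleCount_singleton] at h
  refine h.trans ?_
  unfold CI confRadius
  gcongr
  linarith

/-- Within a cluster the two estimation errors bound the distance of the estimates by `CI_u + CI_v`.
An edge kept between clusters would force `γ ≤ 2 (CI_u + CI_v) < γ`. -/
theorem graph_adj_iff {θ : Fin U → Vec d} {cl : Fin U → Fin J}
    (hcl : ∀ u v, θ u = θ v ↔ cl u = cl v) {γ : ℝ}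
    (hgap : ∀ u v, cl u ≠ cl v → γ ≤ ‖θ u - θ v‖)
    (hest : ∀ u, ‖D.ridge lam {u} - θ u‖ ≤ D.CI lam lt δ u)
    (hCI : ∀ u, D.CI lam lt δ u < γ / 4) (u v : Fin U) :
    (D.graph 1 lam lt δ).Adj u v ↔ u ≠ v ∧ cl u = cl v := by
  change (u ≠ v ∧ ¬ _) ↔ _
  refine and_congr_right fun _ => ?_
  rw [gt_iff_lt, one_mul, not_lt]
  have hu := hest u
  have hv := hest v
  constructor
  · intro h
    by_contra hne
    have h1 := hgap u v hne
    have h2 : ‖θ u - θ v‖ ≤ ‖D.ridge lam {u} - θ u‖ + ‖D.ridge lam {u} - D.ridge lam {v}‖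
        + ‖D.ridge lam {v} - θ v‖ := by
      have h3 : θ u - θ v = -(D.ridge lam {u} - θ u) + (D.ridge lam {u} - D.ridge lam {v})
          + (D.ridge lam {v} - θ v) := by abel
      rw [h3]
      refine (norm_add_le _ _).trans (add_le_add_left ((norm_add_le _ _).trans_eq ?_) _)
      rw [norm_neg]
    linarith [hCI u, hCI v]
  · intro h
    have hθ := (hcl u v).2 h
    have h3 : D.ridge lam {u} - D.ridge lam {v}
        = (D.ridge lam {u} - θ u) - (D.ridge lam {v} - θ v) := by rw [hθ]; abel
    rw [h3]
    exact (norm_sub_le _ _).trans (add_le_add hu hv)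

/-- A path cannot leave a cluster, and distinct members are already adjacent, so components and
closed neighbourhoods coincide. -/
theorem clustersCorrectly_of_adj_iff {cl : Fin U → Fin J} {α : ℝ}
    (h : ∀ u v, (D.graph α lam lt δ).Adj u v ↔ u ≠ v ∧ cl u = cl v) :
    D.ClustersCorrectly cl α lam lt δ := by
  refine fun u => ⟨?_, ?_⟩
  · ext v
    rw [SimpleGraph.ConnectedComponent.mem_supp_iff, SimpleGraph.ConnectedComponent.eq]
    constructor
    · rintro ⟨p⟩
      induction p with
      | nil => rfl
      | cons hadj _ ih => exact ((h _ _).1 hadj).2.trans ih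
    · intro hv
      by_cases huv : v = u
      · rw [huv]
      · exact ((h v u).2 ⟨huv, hv⟩).reachable
  · ext v
    simp only [pool, Finset.coe_filter, Finset.mem_univ, true_and, Set.mem_ofPred_eq, h]
    constructor
    · rintro (rfl | ⟨-, h⟩)
      · rfl
      · exact h.symm
    · intro hv
      by_cases huv : v = u
      · exact Or.inl huv
      · exact Or.inr ⟨fun h => huv h.symm, hv.symm⟩

/-- The pessimistic value is a lower bound for the reward at `a`, and falls short of the reward at
`b` by at most twice the width at `b`. As `a` maximizes it, the width at `a` cancels and only that
at `b` remains. -/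
theorem subOpt_le {θ : Vec d} (hθ : ‖θ‖ ≤ 1) (hD : D.Exciting lt) (hlam : 0 < lam) (hlt : 0 < lt)
    {α : ℝ} {u : Fin U} (hn : D.NoiseBounded lam δ θ (D.pool α lam lt δ u))
    {A : Set (Vec d)} {a : Vec d} (hA : ∀ b ∈ A, ‖b‖ ≤ 1)
    (ha : D.IsOffCLUBAction α lam lt δ u A a) :
    subOpt θ A a ≤ 2 * confRadius U d lam δ (sampleCount D.N (D.pool α lam lt δ u))
      / √(lam + lt * sampleCount D.N (D.pool α lam lt δ u) / 2) := by
  rw [subOpt, sub_le_iff_le_add]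
  refine csSup_le (Set.Nonempty.image _ ⟨a, ha.1⟩) ?_
  rintro _ ⟨b, hb, rfl⟩
  have hmax := ha.2 b hb
  unfold pessimisticValue at hmax
  set V := D.pool α lam lt δ u
  set m := lam + lt * sampleCount D.N V / 2 with hm
  have hm0 : 0 < m := by positivity
  have h1 := inner_ridge_sub_le hlam hθ hn a
  have h2 := inner_ridge_sub_le hlam hθ hn (-b)
  have h3 := sqrt_dotProduct_gram_inv_le hlam hm0 (hD.le_gram lam V) b
  have hβ : √(d * Real.log (1 + sampleCount D.N V / (lam * d)) + 2 * Real.log (2 * U / δ)) + √lam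
      = confRadius U d lam δ (sampleCount D.N V) := rfl
  rw [hβ] at h1 h2
  set β := confRadius U d lam δ (sampleCount D.N V)
  have hβ0 : 0 ≤ β := confRadius_nonneg _ _ _ _ _
  simp only [WithLp.ofLp_neg, Matrix.mulVec_neg, dotProduct_neg, neg_dotProduct, neg_neg,
    inner_neg_right] at h2
  rw [inner_sub_left] at h1 h2
  have h4 : β * √(b.ofLp ⬝ᵥ ((D.gram lam V)⁻¹ *ᵥ b.ofLp)) ≤ β * (1 / √m) :=
    mul_le_mul_of_nonneg_left
      (h3.trans (div_le_div_of_nonneg_right (hA b hb) (Real.sqrt_nonneg _))) hβ0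
  have h5 : 2 * β / √m = 2 * (β * (1 / √m)) := by ring
  rw [h5]
  linarith

end Dataset

/-- Outside an event of probability at most `2δ`, all actions are exciting and the confidence
ellipsoids of all single users and of all true clusters are valid. -/
theorem OfflineData.exists_confidence_event {Ω : Type*} [MeasurableSpace Ω] {P : Measure Ω}
    [IsProbabilityMeasure P] {U d J S : ℕ} {θ : Fin U → Vec d} {ρ : Measure (Vec d)}
    (X : OfflineData P θ ρ S) {lamA σ : ℝ} (hρ : ActionRegular ρ lamA σ)
    {cl : Fin U → Fin J} (hcl : ∀ u v, θ u = θ v ↔ cl u = cl v) {δ lam : ℝ}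
    (hδ₀ : 0 < δ) (hδ₁ : δ < 1 / 2) (hlam : 0 < lam)
    (hN : ∀ u, 16 / smoothedReg lamA σ S ^ 2
      * Real.log (8 * d * U / (smoothedReg lamA σ S ^ 2 * δ)) ≤ X.N u) :
    ∃ B : Set Ω, P B ≤ ENNReal.ofReal (2 * δ) ∧ ∀ ω ∉ B,
      (X.dataset ω).Exciting (smoothedReg lamA σ S) ∧
      (∀ u, (X.dataset ω).NoiseBounded lam δ (θ u) {u}) ∧
      ∀ u, (X.dataset ω).NoiseBounded lam δ (θ u) (trueCluster cl u) := by
  let B₁ : Fin U → Set Ω := fun u => {ω | ¬ ∀ v : Vec d,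
    smoothedReg lamA σ S * X.N u / 2 * ‖v‖ ^ 2 ≤ ∑ i, ⟪v, X.act u i ω⟫ ^ 2}
  let B₂ : Fin U → Set Ω := fun u => {ω | ¬ (X.dataset ω).NoiseBounded lam δ (θ u) {u}}
  let B₃ : Fin U → Set Ω := fun u =>
    {ω | ¬ (X.dataset ω).NoiseBounded lam δ (θ u) (trueCluster cl u)}
  have hB₁ : ∀ u, P (B₁ u) ≤ ENNReal.ofReal (δ / U) := fun u =>
    X.measure_not_half_le_sum_inner_sq_le hρ hδ₀ hδ₁ u (hN u)
  -- The level `δ / (2U)` produces the term `log (2U/δ)` of the radius. Per user the budget is `δ/U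
  -- + 2 · δ/(2U) = 2δ/U`. True clusters are counted once per user, so their number does not enter.
  have hnoise : ∀ u (V : Finset (Fin U)), (∀ v ∈ V, θ v = θ u) →
      P {ω | ¬ (X.dataset ω).NoiseBounded lam δ (θ u) V} ≤ ENNReal.ofReal (δ / (2 * U)) := by
    intro u V hV
    have hU : (0 : ℝ) < U := by exact_mod_cast u.pos
    have h := X.measure_noise_gt_le hρ.norm_le hρ.dim_pos hlam hV
      (ε := δ / (2 * U)) (by positivity)
    simp only [one_div_div] at h
    simp only [Dataset.NoiseBounded, not_le]
    exact h
  have hB₂ : ∀ u, P (B₂ u) ≤ ENNReal.ofReal (δ / (2 * U)) := fun u =>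
    hnoise u {u} fun v hv => by rw [Finset.mem_singleton.1 hv]
  have hB₃ : ∀ u, P (B₃ u) ≤ ENNReal.ofReal (δ / (2 * U)) := fun u =>
    hnoise u _ fun v hv => (hcl v u).2 (mem_trueCluster.1 hv)
  refine ⟨⋃ u, (B₁ u ∪ B₂ u ∪ B₃ u), ?_, fun ω hω => ?_⟩
  · have hstep : ∀ u, P (B₁ u ∪ B₂ u ∪ B₃ u) ≤ ENNReal.ofReal (2 * δ / U) := fun u => by
      have hU : (0 : ℝ) < U := by exact_mod_cast u.pos
      calc _ ≤ P (B₁ u) + P (B₂ u) + P (B₃ u) :=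
            (measure_union_le _ _).trans (add_le_add_left (measure_union_le _ _) _)
        _ ≤ ENNReal.ofReal (δ / U) + ENNReal.ofReal (δ / (2 * U))
              + ENNReal.ofReal (δ / (2 * U)) :=
            add_le_add (add_le_add (hB₁ u) (hB₂ u)) (hB₃ u)
        _ = _ := by
            rw [← ENNReal.ofReal_add (by positivity) (by positivity),
              ← ENNReal.ofReal_add (by positivity) (by positivity)]
            congr 1
            field_simp
            ring
    calc _ ≤ ∑ u, P (B₁ u ∪ B₂ u ∪ B₃ u) := measure_iUnion_fintype_le _ _
      _ ≤ ∑ _u : Fin U, ENNReal.ofReal (2 * δ / U) := Finset.sum_le_sum fun u _ => hstep u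
      _ = ENNReal.ofReal (U * (2 * δ / U)) := by
          rw [Finset.sum_const, Finset.card_univ, Fintype.card_fin, nsmul_eq_mul,
            ENNReal.ofReal_mul (Nat.cast_nonneg _), ENNReal.ofReal_natCast]
      _ ≤ _ := by
          refine ENNReal.ofReal_le_ofReal ?_
          rcases Nat.eq_zero_or_pos U with h | h
          · simp only [h, Nat.cast_zero, zero_mul]
            positivity
          · have hU : (U : ℝ) ≠ 0 := by exact_mod_cast h.ne'
            exact (mul_div_cancel₀ _ hU).le
  · simp only [Set.mem_iUnion, Set.mem_union, not_exists, not_or] at hω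
    exact ⟨fun u => not_not.1 (hω u).1.1, fun u => not_not.1 (hω u).1.2,
      fun u => not_not.1 (hω u).2⟩

end OffClusBand

/-! ### Assembly of the main theorem -/

open OffClusBand in
theorem mainTheorem2 {Ω : Type*} [MeasurableSpace Ω] (P : Measure Ω) [IsProbabilityMeasure P]
    (U d J S : ℕ)
    -- preference vectors and their clusters
    (θ : Fin U → Vec d) (hθ : ∀ u, ‖θ u‖ ≤ 1)
    (cl : Fin U → Fin J) (hcl : ∀ u v, θ u = θ v ↔ cl u = cl v)
    (γ : ℝ) (hγ : 0 < γ) (hgap : ∀ u v, cl u ≠ cl v → γ ≤ ‖θ u - θ v‖)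
    -- action regularity and the random dataset
    (ρ : Measure (Vec d)) (lamA σ : ℝ) (hρ : ActionRegular ρ lamA σ)
    (X : OfflineData P θ ρ S)
    (lt : ℝ) (hlt : lt = smoothedReg lamA σ S)
    -- parameters
    (δ : ℝ) (hδ₀ : 0 < δ) (hδ₁ : δ < 1 / 2) (lam : ℝ) (hlam : 0 < lam)
    (hsuff : CompletelySufficient d X.N lt γ δ)
    (hlam_le : ∀ u, lam ≤ d * Real.log (1 + X.N u / (lam * d)) + 2 * Real.log (2 * U / δ))
    (hδ_le : δ ≤ 2 * U / (1 + gapThreshold U d lt γ δ / (lam * d))) :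
    ∃ E : Set Ω, MeasurableSet E ∧ 1 - 2 * δ ≤ P.real E ∧ ∀ ω ∈ E,
      (X.dataset ω).ClustersCorrectly cl 1 lam lt δ ∧
      ∀ (uTest : Fin U) (A : Set (Vec d)) (a : Vec d), (∀ b ∈ A, ‖b‖ ≤ 1) →
        (X.dataset ω).IsOffCLUBAction 1 lam lt δ uTest A a →
          subOpt (θ uTest) A a ≤
            2 * confRadius U d lam δ (sampleCount X.N (trueCluster cl uTest)) /
              √(lam + lt * sampleCount X.N (trueCluster cl uTest) / 2) ∧
          subOpt (θ uTest) A a ≤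
            8 * √(d / (lt * sampleCount X.N (trueCluster cl uTest))) *
              √(Real.log (1 + sampleCount X.N (trueCluster cl uTest) / (lam * d))
                + Real.log (2 * U / δ)) := by
  subst hlt
  set lt := smoothedReg lamA σ S with hlt
  have hlt0 : 0 < lt := smoothedReg_pos hρ.lamA_pos hρ.sigma_pos S
  have hd := hρ.dim_pos
  obtain ⟨B, hB, hgood⟩ := X.exists_confidence_event hρ hcl hδ₀ hδ₁ hlam
    fun u => (le_max_left _ _).trans (hsuff u)
  -- The bad set is not known to be measurable, so its measurable hull, of the same measure, is
  -- removed.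
  refine ⟨(toMeasurable P B)ᶜ, (measurableSet_toMeasurable P B).compl, ?_, fun ω hω => ?_⟩
  · rw [probReal_compl_eq_one_sub (measurableSet_toMeasurable P B), measureReal_def,
      measure_toMeasurable]
    have h := ENNReal.toReal_le_of_le_ofReal (by positivity) hB
    linarith
  · obtain ⟨hexc, hsingle, hclus⟩ := hgood ω fun h => hω (subset_toMeasurable P B h)
    have hgapN : ∀ u, gapThreshold U d lt γ δ ≤ X.N u := fun u =>
      (le_max_right _ _).trans (hsuff u)
    have hN : ∀ u : Fin U, 0 < X.N u := fun u => by
      have h0 : 0 < gapThreshold U d lt γ δ := by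
        have := Real.log_pos (one_lt_two_mul_div u.pos hδ₀ hδ₁)
        unfold gapThreshold
        positivity
      exact_mod_cast h0.trans_le (hgapN u)
    have hcc : (X.dataset ω).ClustersCorrectly cl 1 lam lt δ := by
      refine Dataset.clustersCorrectly_of_adj_iff (Dataset.graph_adj_iff hcl hgap
        (fun u => Dataset.norm_ridge_singleton_sub_le hexc hlam hlt0 (hθ u) (hN u) (hsingle u))
        fun u => ?_)
      exact confRadius_div_sqrt_lt u.pos hd hlam hlt0 hγ hδ₀ hδ₁ (hgapN u) (hlam_le u) hδ_le
    refine ⟨hcc, fun u A a hA ha => ?_⟩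
    -- The pool is random, whereas the noise bound holds for sets fixed in advance; correct
    -- clustering identifies the two.
    have hpool : (X.dataset ω).pool 1 lam lt δ u = trueCluster cl u := by
      ext v
      have h := Set.ext_iff.1 (hcc u).2 v
      rw [mem_trueCluster]
      simpa using h
    have hsub := Dataset.subOpt_le (hθ u) hexc hlam hlt0 (hpool ▸ hclus u) hA ha
    rw [hpool] at hsub
    refine ⟨hsub, hsub.trans ?_⟩
    have hle := le_sampleCount_trueCluster X.N cl u
    -- The condition on `λ` at `N_u` passes to the larger cluster size by monotonicity of the
    -- logarithm.
    refine two_mul_confRadius_div_le u.pos hd hlam hlt0 hδ₀ hδ₁ ((hN u).trans_le hle)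
      ((hlam_le u).trans ?_)
    gcongr
    exact hle
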